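/- Let $K$ be a number of receivers, let $\mathcal X,\mathcal W$ and $\mathcal Y_k,\mathcal U_k,\mathcal V_k$ ($1\le k\le K$) be finite alphabets, let $(X,Y_1,\dots,Y_K)$ be a source/side-information tuple with an arbitrary joint pmf on $\mathcal X\times\mathcal Y_1\times\cdots\times\mathcal Y_K$, and let $T(u_1,\dots,u_K\mid w)$ be an arbitrary conditional pmf (a memoryless broadcast channel from $\mathcal W$ to $\mathcal U_1\times\cdots\times\mathcal U_K$). Fix a rational bandwidth expansion factor $\kappa>0$, helper rates $\boldsymbol R=(R_1,\dots,R_K)$ with $R_k\ge 0$, and scalar quantisers $\boldsymbol\phi=(\phi_1,\dots,\phi_K)$, $\phi_k:\mathcal W\to\mathcal V_k$. An $(n_s,n_c,R_1,\dots,R_K)$-code consists of an encoder $f:\mathcal X^{n_s}\to\mathcal W^{n_c}$, helper encoders $f_k:\mathcal V_k^{n_c}\to\{1,\dots,\lfloor 2^{n_sR_k}\rfloor\}$ and decoders $g_k:\mathcal U_k^{n_c}\times\mathcal Y_k^{n_s}\times\{1,\dots,\lfloor 2^{n_sR_k}\rfloor\}\to\mathcal X^{n_s}$. The source emits $n_s$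 i.i.d. copies $(\mathbf X,\mathbf Y_1,\dots,\mathbf Y_K)$ of $(X,Y_1,\dots,Y_K)$; the codeword $\mathbf W=f(\mathbf X)$ is sent over $n_c$ uses of the memoryless channel $T$ and is received as $\mathbf U_k$ at receiver $k$; helper $k$ observes $\mathbf V_k=(\phi_k(W_1),\dots,\phi_k(W_{n_c}))$ and sends $M_k=f_k(\mathbf V_k)$ noiselessly to receiver $k$, which outputs $\hat{\mathbf X}_k=g_k(\mathbf U_k,\mathbf Y_k,M_k)$. The tuple $(X,Y_1,\dots,Y_K)$ is $(\kappa,\boldsymbol R,\boldsymbol\phi)$-achievable if for every $\epsilon>0$ and all sufficiently large $n_s,n_c$ with $n_c/n_s=\kappa$ there is an $(n_s,n_c,R_1,\dots,R_K)$-code with $\Pr[\hat{\mathbf X}_k\ne\mathbf X]\le\epsilon$ for all $k$. For a pmf $P_W$ on $\mathcal W$ let $(W,U_1,\dots,U_K)\sim P_W(\cdot)T(\cdot\mid\cdot)$ and $V_k=\phi_k(W)$; entropies and informations are in bits. Then: 1. If there is a pmf $P_W$ on $\mathcal W$ such that for all $k$ $$H(X\mid Y_k)<\kappa I(W;U_k)+\min\{R_k,\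 \kappa I(W;V_k\mid U_k)\},$$ then $(X,Y_1,\dots,Y_K)$ is $(\kappa,\boldsymbol R,\boldsymbol\phi)$-achievable. 2. If $(X,Y_1,\dots,Y_K)$ is $(\kappa,\boldsymbol R,\boldsymbol\phi)$-achievable, then there is a pmf $P_W$ on $\mathcal W$ such that for all $k$ $$H(X\mid Y_k)\le\kappa I(W;U_k)+\min\{R_k,\ \kappa I(W;V_k\mid U_k)\}.$$ The same conclusion holds if, for every $\epsilon>0$, such codes exist only for some arbitrarily large $n_s,n_c$ with $n_c/n_s=\kappa$. -/

import Mathlib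

noncomputable section

namespace BSCoop

/-! ### Entropies, in bits, of random variables on a finite probability space -/

section Entropy

variable {Ω α β γ : Type*}

/-- `Pr[A = a]` for a random variable `A` on the discrete probability space `(Ω, p)`. -/
def prob (p : PMF Ω) (A : Ω → α) (a : α) : ℝ := (p.map A a).toReal

/-- Shannon entropy `H(A)`. -/
def entropy [Fintype α] (p : PMF Ω) (A : Ω → α) : ℝ :=
  -∑ a, prob p A a * Real.logb 2 (prob p A a)

/-- Conditional entropy `H(A|B) = -∑ Pr[A = a, B = b] log₂ Pr[A = a | B = b]`. Pairs of probability
zero contribute `0`. -/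
def condEntropy [Fintype α] [Fintype β] (p : PMF Ω) (A : Ω → α) (B : Ω → β) : ℝ :=
  -∑ a, ∑ b, prob p (fun ω => (A ω, B ω)) (a, b) *
    Real.logb 2 (prob p (fun ω => (A ω, B ω)) (a, b) / prob p B b)

/-- Mutual information `I(A;B) = H(A) - H(A|B)`. -/
def mutualInfo [Fintype α] [Fintype β] (p : PMF Ω) (A : Ω → α) (B : Ω → β) : ℝ :=
  entropy p A - condEntropy p A B

/-- Conditional mutual information `I(A;B|C) = H(A|C) - H(A|B,C)`. -/
def condMutualInfo [Fintype α] [Fintype β] [Fintype γ] (p : PMF Ω)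
    (A : Ω → α) (B : Ω → β) (C : Ω → γ) : ℝ :=
  condEntropy p A C - condEntropy p A (fun ω => (B ω, C ω))

end Entropy

/-! ### The base-station cooperation model, Mode 1 -/

section Model

variable {K : ℕ} {X W : Type*} {Y U V : Fin K → Type*}

/-- The joint law of `(W, (U_1, …, U_K)) ∼ P_W(·) T(·|·)`. -/
def channelLaw (PW : PMF W) (T : W → PMF (∀ k, U k)) : PMF (W × (∀ k, U k)) :=
  PW.bind fun w => (T w).map (Prod.mk w)

/-- The number `⌊2 ^ (n_s r)⌋` of messages of a helper of rate `r`, in bits per source symbol. -/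
def numMessages (ns : ℕ) (r : ℝ) : ℕ := ⌊(2 : ℝ) ^ ((ns : ℝ) * r)⌋₊

/-- An `(n_s, n_c, R_1, …, R_K)`-code. -/
structure Code (X W : Type*) (Y U V : Fin K → Type*) (ns nc : ℕ) (R : Fin K → ℝ) where
  /-- encoder `f` of the main base station -/
  enc : (Fin ns → X) → (Fin nc → W)
  /-- encoder `f_k` of helper `k` -/
  helper : ∀ k, (Fin nc → V k) → Fin (numMessages ns (R k))
  /-- decoder `g_k` of receiver `k` -/
  dec : ∀ k, (Fin nc → U k) → (Fin ns → Y k) → Fin (numMessages ns (R k)) → (Fin ns → X)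

variable {ns nc : ℕ} {R : Fin K → ℝ}

/-- Receiver `k`'s reconstruction when the source emits `x`, the side information at receiver `k`
is `y` and the channel output at receiver `k` is `u`; helper `k` observes the symbol-by-symbol
quantised codeword. -/
def Code.reconstruct (c : Code X W Y U V ns nc R) (φ : ∀ k, W → V k) (k : Fin K)
    (x : Fin ns → X) (y : Fin ns → Y k) (u : Fin nc → U k) : Fin ns → X :=
  c.dec k u y (c.helper k fun j => φ k (c.enc x j))

open Classical in
/-- `Pr[X̂_k ≠ X]`: the source and side information `z` are i.i.d. with law `P`, and, given the
codeword, the channel outputs `u` are drawn from the memoryless channel `T`. -/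
def Code.errorProb [Fintype X] [∀ k, Fintype (Y k)] [∀ k, Fintype (U k)]
    (c : Code X W Y U V ns nc R) (P : PMF (X × (∀ k, Y k))) (T : W → PMF (∀ k, U k))
    (φ : ∀ k, W → V k) (k : Fin K) : ℝ :=
  ∑ z : Fin ns → X × (∀ k, Y k), ∑ u : Fin nc → (∀ k, U k),
    if c.reconstruct φ k (fun i => (z i).1) (fun i => (z i).2 k) (fun j => u j k)
        ≠ (fun i => (z i).1) then
      (∏ i, (P (z i)).toReal) * ∏ j, (T (c.enc (fun i => (z i).1) j) (u j)).toReal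
    else 0

/-- `(κ, R, φ)`-achievability: for every `ε > 0` there are, for all sufficiently large blocklengths
with `n_c / n_s = κ`, codes with error probability at most `ε` at every receiver. -/
def Achievable [Fintype X] [∀ k, Fintype (Y k)] [∀ k, Fintype (U k)]
    (P : PMF (X × (∀ k, Y k))) (T : W → PMF (∀ k, U k)) (κ : ℚ) (R : Fin K → ℝ)
    (φ : ∀ k, W → V k) : Prop :=
  ∀ ε : ℝ, 0 < ε → ∃ N : ℕ, ∀ ns nc : ℕ, N ≤ ns → N ≤ nc → (nc : ℚ) / (ns : ℚ) = κ →
    ∃ c : Code X W Y U V ns nc R, ∀ k, c.errorProb P T φ k ≤ ε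

/-- The weaker notion in which codes are required for some arbitrarily large blocklengths only. -/
def WeaklyAchievable [Fintype X] [∀ k, Fintype (Y k)] [∀ k, Fintype (U k)]
    (P : PMF (X × (∀ k, Y k))) (T : W → PMF (∀ k, U k)) (κ : ℚ) (R : Fin K → ℝ)
    (φ : ∀ k, W → V k) : Prop :=
  ∀ ε : ℝ, 0 < ε → ∀ N : ℕ, ∃ ns nc : ℕ, N ≤ ns ∧ N ≤ nc ∧ (nc : ℚ) / (ns : ℚ) = κ ∧
    ∃ c : Code X W Y U V ns nc R, ∀ k, c.errorProb P T φ k ≤ ε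

/-- `H(X|Y_k)`. -/
def sourceEquivocation [Fintype X] [∀ k, Fintype (Y k)]
    (P : PMF (X × (∀ k, Y k))) (k : Fin K) : ℝ :=
  condEntropy P (fun z => z.1) (fun z => z.2 k)

/-- `κ I(W;U_k) + min {R_k, κ I(W;V_k|U_k)}`, where `(W, U_1, …, U_K) ∼ P_W(·) T(·|·)` and
`V_k = φ_k(W)`. -/
def helperBound [Fintype W] [∀ k, Fintype (U k)] [∀ k, Fintype (V k)]
    (PW : PMF W) (T : W → PMF (∀ k, U k)) (κ : ℚ) (R : Fin K → ℝ) (φ : ∀ k, W → V k)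
    (k : Fin K) : ℝ :=
  (κ : ℝ) * mutualInfo (channelLaw PW T) (fun s => s.1) (fun s => s.2 k) +
    min (R k) ((κ : ℝ) *
      condMutualInfo (channelLaw PW T) (fun s => s.1) (fun s => φ k s.1) (fun s => s.2 k))

end Model

end BSCoop

end

noncomputable section

namespace BSCoop

open Finset

/-! ### Finite sums over product spaces -/

section Tools

/-! By the chain rule, `κ I(W;U_k) + min {R_k, κ I(W;V_k|U_k)}` is the smaller of `κ I(W;U_k) + R_k`
and `κ I(W;V_k,U_k)`. Each receiver thus faces two cuts: the channel to `U_k` supplemented by a rate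
`R_k`, and the channel to the pair `(V_k, U_k)`, as if a genie revealed the whole quantised
codeword.

Achievability is joint source-channel random coding. Every source word gets an independent codeword
with i.i.d. letters from `P_W`, and each helper bins its quantised words at random. Receiver `k`
picks a source word that is likely given its side information, whose codeword has high information
density with `U_k` and, together with its own quantisation, with `(V_k, U_k)`, and whose
quantisation lies in the announced bin. About `exp (n_s H(X|Y_k))` words are likely. A wrong one
whose quantisation differs from the true one must collide in the bin and pass the `U_k` test (first
cut); one with the same quantisation must pass the test on the true `(V_k, U_k)` (second cut). The
bound obtained by averaging over binnings depends only on the codebook (`exists_binning`), so one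
codebook serves all receivers (`codebook_average_le`, `achievable_of_lt`).

The converse compares the true law with an auxiliary law built from the decoder and an arbitrary
output law `q` (`condEnt_le_of_decoder`); this does the work of Fano's inequality. With `q` a
product of the output law under the position-averaged codeword symbol, divergences add over
positions and give `n_c` times a single-letter information (`block_condEnt_le`). The averaged symbol
depends on the encoder alone, so the same input law works for both cuts and all receivers.
Compactness of the simplex and continuity of information remove the slack
(`exists_pmf_of_weaklyAchievable`). -/

open Classical in
/-- The indicator of a proposition, as a real number. -/
def ind (q : Prop) : ℝ := if q then 1 else 0

theorem ind_true {q : Prop} (h : q) : ind q = 1 := by simp [ind, h]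

theorem ind_false {q : Prop} (h : ¬q) : ind q = 0 := by simp [ind, h]

theorem ind_nonneg (q : Prop) : 0 ≤ ind q := by
  unfold ind; split_ifs <;> norm_num

theorem ind_congr {q r : Prop} (h : q ↔ r) : ind q = ind r := by rw [propext h]

theorem sum_ind_eq_mul {B : Type*} [Fintype B] (b : B) (F : B → ℝ) :
    ∑ b', ind (b = b') * F b' = F b := by
  classical simp [ind]

theorem sum_ind_eq {B : Type*} [Fintype B] (b : B) : ∑ b', ind (b = b') = 1 := by
  simpa using sum_ind_eq_mul b (fun _ => (1 : ℝ))

variable {ι A B : Type*} [Fintype ι] [Fintype A]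

theorem prod_ind (q : ι → Prop) : ∏ i, ind (q i) = ind (∀ i, q i) := by
  by_cases h : ∀ i, q i
  · rw [ind_true h]; exact Finset.prod_eq_one fun i _ => ind_true (h i)
  · rw [ind_false h]; push Not at h
    obtain ⟨i, hi⟩ := h
    exact Finset.prod_eq_zero (mem_univ i) (ind_false hi)

/-- The image of the weights `q` under the map `h`. -/
def push (q : A → ℝ) (h : A → B) (b : B) : ℝ := ∑ a, q a * ind (h a = b)

theorem push_nonneg {q : A → ℝ} (hq : ∀ a, 0 ≤ q a) (h : A → B) (b : B) : 0 ≤ push q h b :=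
  sum_nonneg fun a _ => mul_nonneg (hq a) (ind_nonneg _)

theorem sum_push_mul [Fintype B] (q : A → ℝ) (h : A → B) (F : B → ℝ) :
    ∑ b, push q h b * F b = ∑ a, q a * F (h a) := by
  simp only [push, sum_mul]
  rw [sum_comm]
  refine sum_congr rfl fun a _ => ?_
  simp only [mul_assoc, ← mul_sum, sum_ind_eq_mul]

theorem sum_push [Fintype B] (q : A → ℝ) (h : A → B) : ∑ b, push q h b = ∑ a, q a := by
  simpa using sum_push_mul q h (fun _ => 1)

theorem push_pos {q : A → ℝ} (hq : ∀ a, 0 ≤ q a) (h : A → B) {a : A} (ha : 0 < q a) :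
    0 < push q h (h a) := by
  refine sum_pos' (fun a _ => mul_nonneg (hq a) (ind_nonneg _)) ⟨a, mem_univ a, ?_⟩
  rw [ind_true rfl, mul_one]; exact ha

theorem sum_pi_prod [DecidableEq ι] (f : ι → A → ℝ) :
    ∑ z : ι → A, ∏ i, f i (z i) = ∏ i, ∑ a, f i a := by
  rw [Finset.prod_univ_sum, Fintype.piFinset_univ]

theorem sum_pi_push [DecidableEq ι] [Fintype B] (q : ι → A → ℝ) (h : ι → A → B)
    (F : (ι → B) → ℝ) :
    ∑ b : ι → B, (∏ j, push (q j) (h j) (b j)) * F b =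
      ∑ u : ι → A, (∏ j, q j (u j)) * F (fun j => h j (u j)) := by
  have : ∀ b : ι → B, (∏ j, push (q j) (h j) (b j)) =
      push (fun u : ι → A => ∏ j, q j (u j)) (fun u j => h j (u j)) b := by
    intro b
    simp only [push]
    rw [← sum_pi_prod (fun j a => q j a * ind (h j a = b j))]
    refine sum_congr rfl fun u _ => ?_
    rw [prod_mul_distrib, prod_ind]
    congr 1
    exact ind_congr (by simp [funext_iff])
  simp only [this]
  exact sum_push_mul _ _ _

theorem sum_pi_prod_eq_one [DecidableEq ι] {f : ι → A → ℝ} (hf : ∀ i, ∑ a, f i a = 1) :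
    ∑ z : ι → A, ∏ i, f i (z i) = 1 := by
  rw [sum_pi_prod]; exact prod_eq_one fun i _ => hf i

theorem sum_pi_mul_mul [DecidableEq ι] {f : ι → A → ℝ} (hf : ∀ i, ∑ a, f i a = 1) {i j : ι}
    (hij : i ≠ j) (g h : A → ℝ) :
    ∑ z : ι → A, (∏ l, f l (z l)) * (g (z i) * h (z j)) =
      (∑ a, f i a * g a) * ∑ a, f j a * h a := by
  have key : ∀ z : ι → A, (∏ l, f l (z l)) * (g (z i) * h (z j)) =
      ∏ l, f l (z l) * ((if l = i then g (z l) else 1) * (if l = j then h (z l) else 1)) := by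
    intro z
    rw [prod_mul_distrib, prod_mul_distrib]
    simp
  simp only [key]
  rw [sum_pi_prod (fun l a => f l a * ((if l = i then g a else 1) * (if l = j then h a else 1)))]
  rw [← mul_prod_erase univ _ (mem_univ i),
    ← mul_prod_erase (univ.erase i) _ (mem_erase.2 ⟨hij.symm, mem_univ j⟩)]
  rw [prod_eq_one, mul_one]
  · simp [hij, hij.symm]
  · intro l hl
    simp only [mem_erase, mem_univ, and_true] at hl
    simp [hl.1, hl.2, hf]

theorem sum_pi_pair [DecidableEq ι] {f : ι → A → ℝ} (hf : ∀ i, ∑ a, f i a = 1) {i j : ι}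
    (hij : i ≠ j) (G : A → A → ℝ) :
    ∑ z : ι → A, (∏ l, f l (z l)) * G (z i) (z j) =
      ∑ a, f i a * ∑ b, f j b * G a b := by
  have key : ∀ z : ι → A, (∏ l, f l (z l)) * G (z i) (z j) =
      ∑ a, (∏ l, f l (z l)) * (ind (z i = a) * G a (z j)) := by
    intro z
    rw [← mul_sum, sum_ind_eq_mul (z i) (fun a => G a (z j))]
  simp only [key]
  rw [sum_comm]
  have h2 : ∀ a, ∑ z : ι → A, (∏ l, f l (z l)) * (ind (z i = a) * G a (z j)) =
      (∑ b, f i b * ind (b = a)) * ∑ b, f j b * G a b := fun a =>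
    sum_pi_mul_mul hf hij (fun b => ind (b = a)) (fun b => G a b)
  simp only [h2]
  refine sum_congr rfl fun a _ => ?_
  congr 1
  classical simp [ind]

theorem sum_pi_coord [DecidableEq ι] {f : ι → A → ℝ} (hf : ∀ i, ∑ a, f i a = 1) (i : ι)
    (g : A → ℝ) :
    ∑ z : ι → A, (∏ l, f l (z l)) * g (z i) = ∑ a, f i a * g a := by
  have key : ∀ z : ι → A, (∏ l, f l (z l)) * g (z i) =
      ∏ l, f l (z l) * (if l = i then g (z l) else 1) := by
    intro z
    rw [prod_mul_distrib]
    simp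
  simp only [key]
  rw [sum_pi_prod (fun l a => f l a * (if l = i then g a else 1)),
    ← mul_prod_erase univ _ (mem_univ i), prod_eq_one, mul_one]
  · simp
  · intro l hl
    simp only [mem_erase, mem_univ, and_true] at hl
    simp [hl, hf]

theorem sum_pi_sum [DecidableEq ι] {f : ι → A → ℝ} (hf : ∀ i, ∑ a, f i a = 1)
    (g : ι → A → ℝ) :
    ∑ z : ι → A, (∏ l, f l (z l)) * ∑ i, g i (z i) = ∑ i, ∑ a, f i a * g i a := by
  simp only [mul_sum]
  rw [sum_comm]
  exact sum_congr rfl fun i _ => sum_pi_coord hf i (g i)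

/-- A weighted average bounds some of its terms from above. -/
theorem exists_le_of_average_le {w f : A → ℝ} (hw : ∀ a, 0 ≤ w a) (hw1 : ∑ a, w a = 1) {c : ℝ}
    (h : ∑ a, w a * f a ≤ c) : ∃ a, f a ≤ c := by
  by_contra! hc
  have h1 : ∑ a, w a * c ≤ ∑ a, w a * f a :=
    sum_le_sum fun a _ => mul_le_mul_of_nonneg_left (hc a).le (hw a)
  rw [← sum_mul, hw1, one_mul] at h1
  obtain ⟨a, ha⟩ : ∃ a, 0 < w a := by
    by_contra! h0
    have : ∑ a, w a ≤ 0 := sum_nonpos fun a _ => h0 a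
    linarith
  have h2 : ∑ a, w a * c < ∑ a, w a * f a :=
    sum_lt_sum (fun a _ => mul_le_mul_of_nonneg_left (hc a).le (hw a))
      ⟨a, mem_univ a, mul_lt_mul_of_pos_left (hc a) ha⟩
  rw [← sum_mul, hw1, one_mul] at h2
  linarith

/-- A random variable of negative mean has a moment generating function that falls below one. -/
theorem exists_mgf_lt_one {r g : A → ℝ} (hr1 : ∑ a, r a = 1) (hneg : ∑ a, r a * g a < 0) :
    ∃ s : ℝ, 0 < s ∧ ∑ a, r a * Real.exp (s * g a) < 1 := by
  -- The function equals one at `s = 0` and its derivative there is the mean, so it drops below one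
  -- just to the right of zero.
  have hd : HasDerivAt (fun s : ℝ => ∑ a, r a * Real.exp (s * g a))
      (∑ a, r a * g a) 0 := by
    have : HasDerivAt (fun s : ℝ => ∑ a, r a * Real.exp (s * g a))
        (∑ a, r a * (Real.exp (0 * g a) * (1 * g a))) 0 := by
      refine HasDerivAt.fun_sum fun a _ => ?_
      exact (((hasDerivAt_id (0 : ℝ)).mul_const (g a)).exp).const_mul (r a)
    simpa using this
  have hs := hd.tendsto_slope_zero_right
  have h1 := (hs.eventually_lt_const hneg).and self_mem_nhdsWithin
  obtain ⟨s, hs, hpos⟩ := h1.exists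
  refine ⟨s, hpos, ?_⟩
  have hpos' : (0 : ℝ) < s := hpos
  simp only [zero_add, zero_mul, Real.exp_zero, mul_one, smul_eq_mul, hr1] at hs
  have := (inv_mul_lt_iff₀ hpos').1 hs
  linarith

/-- Exponential form of the weak law of large numbers for log-likelihood ratios. -/
theorem exists_rate_likelihood_le {r f g : A → ℝ} (hr : ∀ a, 0 ≤ r a) (hr1 : ∑ a, r a = 1)
    (hf : ∀ a, 0 < r a → 0 < f a) (hg : ∀ a, 0 < r a → 0 < g a) {t : ℝ}
    (ht : t < ∑ a, r a * Real.log (f a / g a)) :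
    ∃ ρ : ℝ, 0 ≤ ρ ∧ ρ < 1 ∧ ∀ n : ℕ,
      ∑ z : Fin n → A, (∏ i, r (z i)) *
        ind (∏ i, f (z i) ≤ Real.exp (n * t) * ∏ i, g (z i)) ≤ ρ ^ n := by
  -- Chernoff bound: on the event the exponential of `s` times the summed deficits is at least one,
  -- and its expectation factorises into an `n`-th power.
  obtain ⟨s, hs, hlt⟩ := exists_mgf_lt_one (g := fun a => t - Real.log (f a / g a)) hr1 (by
    simp only [mul_sub, sum_sub_distrib, ← sum_mul, hr1]; linarith)
  refine ⟨_, sum_nonneg fun a _ => mul_nonneg (hr a) (Real.exp_pos _).le, hlt, fun n => ?_⟩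
  have hpow : (∑ a, r a * Real.exp (s * (t - Real.log (f a / g a)))) ^ n =
      ∑ z : Fin n → A, ∏ i, (r (z i) * Real.exp (s * (t - Real.log (f (z i) / g (z i))))) := by
    rw [sum_pi_prod (fun (_ : Fin n) a => r a * Real.exp (s * (t - Real.log (f a / g a))))]
    simp
  rw [hpow]
  refine sum_le_sum fun z _ => ?_
  rw [prod_mul_distrib]
  by_cases hz : ∀ i, 0 < r (z i)
  · refine mul_le_mul_of_nonneg_left ?_ (prod_nonneg fun i _ => hr _)
    by_cases hE : ∏ i, f (z i) ≤ Real.exp (n * t) * ∏ i, g (z i)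
    · rw [ind_true hE, ← Real.exp_sum, ← mul_sum]
      refine Real.one_le_exp (mul_nonneg hs.le ?_)
      have hfp : 0 < ∏ i, f (z i) := prod_pos fun i _ => hf _ (hz i)
      have hgp : 0 < ∏ i, g (z i) := prod_pos fun i _ => hg _ (hz i)
      have h1 := Real.log_le_log hfp hE
      rw [Real.log_mul (Real.exp_pos _).ne' hgp.ne', Real.log_exp,
        Real.log_prod (fun i _ => (hf _ (hz i)).ne'),
        Real.log_prod (fun i _ => (hg _ (hz i)).ne')] at h1
      have h2 : ∀ i, Real.log (f (z i) / g (z i)) = Real.log (f (z i)) - Real.log (g (z i)) :=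
        fun i => Real.log_div (hf _ (hz i)).ne' (hg _ (hz i)).ne'
      simp only [h2, sum_sub_distrib, sum_const, card_univ, Fintype.card_fin, nsmul_eq_mul]
      linarith
    · rw [ind_false hE]; exact prod_nonneg fun i _ => (Real.exp_pos _).le
  · push Not at hz
    obtain ⟨i, hi⟩ := hz
    have : ∏ i, r (z i) = 0 := prod_eq_zero (mem_univ i) (le_antisymm hi (hr _))
    simp [this]

end Tools

/-! ### One-shot random coding -/

section OneShot

variable {𝒵 𝒯 𝒳 𝒴 𝒲 𝒰 𝒱 : Type*} [Fintype 𝒵] [Fintype 𝒯] [Fintype 𝒳]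

/-- Union bound on the probability, over a uniformly random binning of `𝒱` into `M` bins, that
the decoder that looks for the unique admissible source word fails. -/
def failureBound (M : ℕ) (F : 𝒳 → 𝒲) (φ : 𝒲 → 𝒱) (ok : 𝒳 → 𝒴 → Prop)
    (A₁ : 𝒲 → 𝒰 → Prop) (A₂ : 𝒲 → 𝒱 × 𝒰 → Prop) (x : 𝒳) (y : 𝒴) (u : 𝒰) : ℝ :=
  ind (¬ok x y) + ind (¬A₁ (F x) u) + ind (¬A₂ (F x) (φ (F x), u)) +
    ∑ x', ind (x' ≠ x) * ind (ok x' y) *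
      ((M : ℝ)⁻¹ * ind (A₁ (F x') u) + ind (A₂ (F x') (φ (F x), u)))

/-- Distinct words fall into independent uniform bins. Coinciding words always collide and are
excluded from the event; the second information-density test handles them. -/
theorem collision_average_le {M : ℕ} (hM : 0 < M) [Fintype 𝒱] [DecidableEq 𝒱] (v v' : 𝒱) :
    ∑ f : 𝒱 → Fin M, (∏ _v : 𝒱, (M : ℝ)⁻¹) * ind (v' ≠ v ∧ f v' = f v) ≤ (M : ℝ)⁻¹ := by
  have hM' : (M : ℝ) ≠ 0 := by positivity
  by_cases h : v' = v
  · simp only [h, ne_eq, not_true_eq_false, false_and, ind_false not_false, mul_zero, sum_const_zero]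
    positivity
  · have h1 : ∑ _a : Fin M, (M : ℝ)⁻¹ = 1 := by simp [hM']
    have := sum_pi_pair (f := fun (_ : 𝒱) (_ : Fin M) => (M : ℝ)⁻¹) (fun _ => h1) h
      (fun a b => ind (a = b))
    simp only [ne_eq, h, not_false_eq_true, true_and]
    rw [this]
    simp only [← mul_sum, sum_ind_eq, sum_const, card_univ, Fintype.card_fin, nsmul_eq_mul,
      mul_one]
    rw [mul_inv_cancel₀ hM', mul_one]

/-- Some binning is no worse than the average. Since the right-hand side contains no binning, the
codebook can be fixed first for all receivers, and the binnings afterwards, one receiver at a time.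
-/
theorem exists_binning [Fintype 𝒱] [Nonempty 𝒳] {M : ℕ} (hM : 0 < M) (ξ : 𝒵 → 𝒳) (η : 𝒵 → 𝒴) (π : 𝒯 → 𝒰)
    (F : 𝒳 → 𝒲) (φ : 𝒲 → 𝒱) {r : 𝒵 → 𝒯 → ℝ} (hr : ∀ z t, 0 ≤ r z t) (ok : 𝒳 → 𝒴 → Prop)
    (A₁ : 𝒲 → 𝒰 → Prop) (A₂ : 𝒲 → 𝒱 × 𝒰 → Prop) :
    ∃ (f : 𝒱 → Fin M) (g : 𝒰 → 𝒴 → Fin M → 𝒳),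
      ∑ z, ∑ t, r z t * ind (g (π t) (η z) (f (φ (F (ξ z)))) ≠ ξ z) ≤
        ∑ z, ∑ t, r z t * failureBound M F φ ok A₁ A₂ (ξ z) (η z) (π t) := by
  classical
  let D : (𝒱 → Fin M) → 𝒰 → 𝒴 → Fin M → 𝒳 → Prop := fun f u y m x =>
    -- The decoder does not know the quantised codeword, so each candidate is tested against its own
    -- quantisation.
    ok x y ∧ A₁ (F x) u ∧ A₂ (F x) (φ (F x), u) ∧ f (φ (F x)) = m
  let g : (𝒱 → Fin M) → 𝒰 → 𝒴 → Fin M → 𝒳 := fun f u y m => Classical.epsilon (D f u y m)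
  let bnd : (𝒱 → Fin M) → 𝒳 → 𝒴 → 𝒰 → ℝ := fun f x y u =>
    ind (¬ok x y) + ind (¬A₁ (F x) u) + ind (¬A₂ (F x) (φ (F x), u)) +
    ∑ x', ind (x' ≠ x) * ind (ok x' y) *
      (ind (φ (F x') ≠ φ (F x) ∧ f (φ (F x')) = f (φ (F x))) * ind (A₁ (F x') u) +
        ind (A₂ (F x') (φ (F x), u)))
  have hbnd : ∀ f x y u, ind (g f u y (f (φ (F x))) ≠ x) ≤ bnd f x y u := by
    intro f x y u
    have hterm : ∀ x', 0 ≤ ind (x' ≠ x) * ind (ok x' y) *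
      (ind (φ (F x') ≠ φ (F x) ∧ f (φ (F x')) = f (φ (F x))) * ind (A₁ (F x') u) +
        ind (A₂ (F x') (φ (F x), u))) := fun x' =>
      mul_nonneg (mul_nonneg (ind_nonneg _) (ind_nonneg _))
        (add_nonneg (mul_nonneg (ind_nonneg _) (ind_nonneg _)) (ind_nonneg _))
    have hsum := sum_nonneg fun x' (_ : x' ∈ univ) => hterm x'
    have n1 := ind_nonneg (¬ok x y)
    have n2 := ind_nonneg (¬A₁ (F x) u)
    have n3 := ind_nonneg (¬A₂ (F x) (φ (F x), u))
    by_cases hE : g f u y (f (φ (F x))) ≠ x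
    swap
    · rw [ind_false hE]; simp only [bnd]; linarith
    rw [ind_true hE]
    simp only [bnd]
    by_cases h1 : ok x y
    swap
    · rw [ind_true h1]; linarith
    by_cases h2 : A₁ (F x) u
    swap
    · rw [ind_true h2]; linarith
    by_cases h3 : A₂ (F x) (φ (F x), u)
    swap
    · rw [ind_true h3]; linarith
    -- The true word is admissible, hence so is the word picked by `Classical.epsilon`; an error
    -- then exhibits an admissible competitor.
    have hD : D f u y (f (φ (F x))) (g f u y (f (φ (F x)))) :=
      Classical.epsilon_spec ⟨x, h1, h2, h3, rfl⟩
    generalize g f u y (f (φ (F x))) = x' at hE hD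
    obtain ⟨d1, d2, d3, d4⟩ := hD
    have hle := single_le_sum (fun x' (_ : x' ∈ univ) => hterm x') (mem_univ x')
    refine le_trans ?_ (le_trans hle (by linarith))
    rw [ind_true hE, ind_true d1, ind_true d2]
    -- With equal quantisations the competitor has passed the second test against the true pair;
    -- otherwise it has collided in the bin and passed the first.
    by_cases hφ : φ (F x') = φ (F x)
    · rw [← hφ, ind_true d3]
      have := ind_nonneg (φ (F x') ≠ φ (F x') ∧ f (φ (F x')) = f (φ (F x')))
      linarith
    · rw [ind_true ⟨hφ, d4⟩]
      have := ind_nonneg (A₂ (F x') (φ (F x), u))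
      linarith
  have hM' : (M : ℝ) ≠ 0 := by positivity
  have hw0 : ∀ _f : 𝒱 → Fin M, 0 ≤ ∏ _v : 𝒱, (M : ℝ)⁻¹ := fun _ =>
    prod_nonneg fun _ _ => by positivity
  have hw1 : ∑ _f : 𝒱 → Fin M, ∏ _v : 𝒱, (M : ℝ)⁻¹ = 1 :=
    sum_pi_prod_eq_one (f := fun (_ : 𝒱) (_ : Fin M) => (M : ℝ)⁻¹) fun _ => by simp [hM']
  have havg : ∀ x y u, ∑ f : 𝒱 → Fin M, (∏ _v : 𝒱, (M : ℝ)⁻¹) * bnd f x y u ≤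
      failureBound M F φ ok A₁ A₂ x y u := by
    intro x y u
    simp only [bnd, mul_add, sum_add_distrib, ← sum_mul, hw1, one_mul, failureBound]
    refine add_le_add le_rfl ?_
    simp only [mul_sum]
    rw [sum_comm]
    simp only [← sum_add_distrib]
    refine sum_le_sum fun x' _ => ?_
    have hc := collision_average_le hM (φ (F x)) (φ (F x'))
    have hcoef : 0 ≤ ind (x' ≠ x) * ind (ok x' y) := mul_nonneg (ind_nonneg _) (ind_nonneg _)
    calc _ = ind (x' ≠ x) * ind (ok x' y) *
          ((∑ f : 𝒱 → Fin M, (∏ _v : 𝒱, (M : ℝ)⁻¹) *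
            ind (φ (F x') ≠ φ (F x) ∧ f (φ (F x')) = f (φ (F x)))) * ind (A₁ (F x') u) +
          ind (A₂ (F x') (φ (F x), u))) := by
          simp only [sum_mul, mul_add, mul_sum]
          congr 1
          exact sum_congr rfl fun f _ => by ring
      _ ≤ _ := by
          rw [← mul_add]
          exact mul_le_mul_of_nonneg_left
            (add_le_add (mul_le_mul_of_nonneg_right hc (ind_nonneg _)) le_rfl) hcoef
  obtain ⟨f, hf⟩ := exists_le_of_average_le hw0 hw1
    (f := fun f => ∑ z, ∑ t, r z t * ind (g f (π t) (η z) (f (φ (F (ξ z)))) ≠ ξ z))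
    (c := ∑ z, ∑ t, r z t * failureBound M F φ ok A₁ A₂ (ξ z) (η z) (π t)) (by
      simp only [mul_sum]
      rw [sum_comm]
      refine sum_le_sum fun z _ => ?_
      rw [sum_comm]
      refine sum_le_sum fun t _ => ?_
      refine le_trans ?_ (mul_le_mul_of_nonneg_left (havg (ξ z) (η z) (π t)) (hr z t))
      rw [mul_sum]
      refine sum_le_sum fun f _ => ?_
      rw [mul_left_comm]
      exact mul_le_mul_of_nonneg_left
        (mul_le_mul_of_nonneg_left (hbnd f _ _ _) (hw0 f)) (hr z t))
  exact ⟨f, g f, hf⟩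

/-- For a fixed source outcome the codewords of two different source words are independent, so each
competitor costs at most `e₁ / M + e₂`, and at most `L` competitors are admissible to the source
test. -/
theorem codebook_average_le [Fintype 𝒲] [DecidableEq 𝒳] (M : ℕ) (ξ : 𝒵 → 𝒳) (η : 𝒵 → 𝒴) (π : 𝒯 → 𝒰)
    (φ : 𝒲 → 𝒱) {p : 𝒵 → ℝ} (hp : ∀ z, 0 ≤ p z) (hp1 : ∑ z, p z = 1)
    {S : 𝒲 → 𝒯 → ℝ} (hS1 : ∀ w, ∑ t, S w t = 1)
    {Q : 𝒲 → ℝ} (hQ1 : ∑ w, Q w = 1)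
    (ok : 𝒳 → 𝒴 → Prop) (A₁ : 𝒲 → 𝒰 → Prop) (A₂ : 𝒲 → 𝒱 × 𝒰 → Prop) {L e₁ e₂ : ℝ}
    (he₁ : 0 ≤ e₁) (he₂ : 0 ≤ e₂)
    (hL : ∀ y, ∑ x, ind (ok x y) ≤ L)
    (h₁ : ∑ w, Q w * ∑ t, S w t * ∑ w', Q w' * ind (A₁ w' (π t)) ≤ e₁)
    (h₂ : ∑ w, Q w * ∑ t, S w t * ∑ w', Q w' * ind (A₂ w' (φ w, π t)) ≤ e₂) :
    ∑ F : 𝒳 → 𝒲, (∏ x, Q (F x)) * ∑ z, ∑ t, p z * S (F (ξ z)) t *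
        failureBound M F φ ok A₁ A₂ (ξ z) (η z) (π t) ≤
      ∑ z, p z * ind (¬ok (ξ z) (η z)) + ∑ w, Q w * ∑ t, S w t * ind (¬A₁ w (π t)) +
        ∑ w, Q w * ∑ t, S w t * ind (¬A₂ w (φ w, π t)) + L * ((M : ℝ)⁻¹ * e₁ + e₂) := by
  have hpi : ∑ F : 𝒳 → 𝒲, ∏ x, Q (F x) = 1 :=
    sum_pi_prod_eq_one (f := fun (_ : 𝒳) => Q) fun _ => hQ1
  let G : 𝒲 → 𝒲 → ℝ := fun w w' =>
    ∑ t, S w t * ((M : ℝ)⁻¹ * ind (A₁ w' (π t)) + ind (A₂ w' (φ w, π t)))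
  have hG : ∑ w, Q w * ∑ w', Q w' * G w w' ≤ (M : ℝ)⁻¹ * e₁ + e₂ := by
    have : ∑ w, Q w * ∑ w', Q w' * G w w' =
        (M : ℝ)⁻¹ * (∑ w, Q w * ∑ t, S w t * ∑ w', Q w' * ind (A₁ w' (π t))) +
          ∑ w, Q w * ∑ t, S w t * ∑ w', Q w' * ind (A₂ w' (φ w, π t)) := by
      simp only [G, mul_sum, mul_add, sum_add_distrib]
      congr 1 <;> refine sum_congr rfl fun w _ => ?_
      · rw [sum_comm]
        exact sum_congr rfl fun t _ => sum_congr rfl fun w' _ => by ring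
      · rw [sum_comm]
        exact sum_congr rfl fun t _ => sum_congr rfl fun w' _ => by ring
    rw [this]
    exact add_le_add (mul_le_mul_of_nonneg_left h₁ (by positivity)) h₂
  have hz : ∀ x y, ∑ F : 𝒳 → 𝒲, (∏ x, Q (F x)) *
      ∑ t, S (F x) t * failureBound M F φ ok A₁ A₂ x y (π t) ≤
      ind (¬ok x y) + (∑ w, Q w * ∑ t, S w t * ind (¬A₁ w (π t))) +
        (∑ w, Q w * ∑ t, S w t * ind (¬A₂ w (φ w, π t))) + L * ((M : ℝ)⁻¹ * e₁ + e₂) := by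
    intro x y
    have hsplit : ∀ F : 𝒳 → 𝒲, ∑ t, S (F x) t * failureBound M F φ ok A₁ A₂ x y (π t) =
        ind (¬ok x y) + (∑ t, S (F x) t * ind (¬A₁ (F x) (π t))) +
        (∑ t, S (F x) t * ind (¬A₂ (F x) (φ (F x), π t))) +
        ∑ x', ind (x' ≠ x) * ind (ok x' y) * G (F x) (F x') := by
      intro F
      simp only [failureBound, mul_add, sum_add_distrib, ← sum_mul, hS1, one_mul]
      congr 1
      simp only [G, mul_sum, mul_add, sum_add_distrib]
      congr 1 <;> rw [sum_comm] <;>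
        exact sum_congr rfl fun t _ => sum_congr rfl fun x' _ => by ring
    simp only [hsplit, mul_add, sum_add_distrib, ← sum_mul, hpi, one_mul]
    refine add_le_add (add_le_add (add_le_add le_rfl (le_of_eq ?_)) (le_of_eq ?_)) ?_
    · exact sum_pi_coord (f := fun _ => Q) (fun _ => hQ1) x
        (fun w => ∑ t, S w t * ind (¬A₁ w (π t)))
    · exact sum_pi_coord (f := fun _ => Q) (fun _ => hQ1) x
        (fun w => ∑ t, S w t * ind (¬A₂ w (φ w, π t)))
    · rw [← mul_add]
      simp only [mul_sum (s := (univ : Finset 𝒳))]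
      rw [sum_comm]
      have he : 0 ≤ (M : ℝ)⁻¹ * e₁ + e₂ := by positivity
      refine le_trans ?_ (mul_le_mul_of_nonneg_right (hL y) he)
      rw [sum_mul]
      refine sum_le_sum fun x' _ => ?_
      by_cases hx : x' = x
      · simp only [hx, ne_eq, not_true_eq_false, ind_false not_false, zero_mul, mul_zero,
          sum_const_zero]
        exact mul_nonneg (ind_nonneg _) he
      · have := sum_pi_pair (f := fun _ : 𝒳 => Q) (fun _ => hQ1) (Ne.symm hx) G
        simp only [mul_left_comm, ← mul_sum]
        rw [this]
        rw [ind_true hx, one_mul]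
        exact mul_le_mul_of_nonneg_left hG (ind_nonneg _)
  calc _ = ∑ z, p z * ∑ F : 𝒳 → 𝒲, (∏ x, Q (F x)) *
      ∑ t, S (F (ξ z)) t * failureBound M F φ ok A₁ A₂ (ξ z) (η z) (π t) := by
        simp only [mul_sum]
        rw [sum_comm]
        refine sum_congr rfl fun z _ => sum_congr rfl fun F _ => sum_congr rfl fun t _ => by ring
    _ ≤ ∑ z, p z * _ := sum_le_sum fun z _ => mul_le_mul_of_nonneg_left (hz _ _) (hp z)
    _ = _ := by simp only [mul_add, sum_add_distrib, ← sum_mul, hp1, one_mul]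

/-- At most `L` words `x` have conditional probability above `1 / L` given `y`. -/
theorem card_likely_le {p : 𝒳 → ℝ} (hp : ∀ x, 0 ≤ p x) {L : ℝ} (hL : 0 ≤ L) :
    ∑ x, ind (∑ x', p x' < L * p x) ≤ L := by
  have h0 : 0 ≤ ∑ x, p x := sum_nonneg fun x _ => hp x
  rcases h0.eq_or_lt with h | h
  · have hz : ∀ x, p x = 0 := fun x =>
      (sum_eq_zero_iff_of_nonneg (f := p) fun x _ => hp x).1 h.symm x (mem_univ x)
    -- The strict inequality matters here: under a null condition no word counts as likely.
    simp only [hz, sum_const_zero, mul_zero, lt_irrefl, ind_false not_false]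
    exact hL
  · refine le_of_mul_le_mul_right ?_ h
    rw [sum_mul, mul_sum _ _ L]
    refine sum_le_sum fun x _ => ?_
    by_cases hx : ∑ x', p x' < L * p x
    · rw [ind_true hx, one_mul]; exact hx.le
    · rw [ind_false hx, zero_mul]; exact mul_nonneg hL (hp x)

/-- An independent codeword exceeds the likelihood threshold `c` with probability at most `1/c`. -/
theorem independent_exceeds_le [Fintype 𝒲] {ℬ : Type*} [Fintype ℬ] {Q : 𝒲 → ℝ} (hQ : ∀ w, 0 ≤ Q w)
    (hQ1 : ∑ w, Q w = 1) {S : 𝒲 → ℬ → ℝ} (hS : ∀ w b, 0 ≤ S w b) (hS1 : ∀ w, ∑ b, S w b = 1)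
    {c : ℝ} (hc : 0 < c) :
    ∑ w, Q w * ∑ b, S w b * ∑ w', Q w' * ind (c * ∑ v, Q v * S v b < S w' b) ≤ c⁻¹ := by
  calc _ = ∑ b, (∑ w, Q w * S w b) *
        ∑ w', Q w' * ind (c * ∑ v, Q v * S v b < S w' b) := by
        simp only [mul_sum (s := (univ : Finset ℬ))]
        rw [sum_comm]
        refine sum_congr rfl fun b _ => ?_
        rw [sum_mul]
        exact sum_congr rfl fun w _ => by ring
    _ ≤ ∑ b, c⁻¹ * ∑ w, Q w * S w b := by
        refine sum_le_sum fun b _ => ?_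
        rw [mul_sum _ _ (∑ w, Q w * S w b), mul_sum _ _ c⁻¹]
        refine sum_le_sum fun w _ => ?_
        -- Change of measure: on the event the output law at `b` is below `S w b / c`, and the sum
        -- of `Q w * S w b` is one.
        by_cases h : c * ∑ v, Q v * S v b < S w b
        · rw [ind_true h, mul_one, mul_comm, ← mul_assoc, mul_comm _ (Q w), mul_assoc]
          refine mul_le_mul_of_nonneg_left ?_ (hQ w)
          rw [← div_eq_inv_mul, le_div_iff₀ hc, mul_comm]
          exact h.le
        · rw [ind_false h, mul_zero, mul_zero]
          exact mul_nonneg (by positivity) (mul_nonneg (hQ w) (hS w b))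
    _ = _ := by
        rw [← mul_sum, sum_comm]
        simp only [← mul_sum, hS1, mul_one, hQ1]

end OneShot

/-! ### Single-letter quantities, in nats -/

section SingleLetter

/-- The weights of a probability mass function, as real numbers. -/
def wt {Ω : Type*} (P : PMF Ω) (ω : Ω) : ℝ := (P ω).toReal

theorem wt_nonneg {Ω : Type*} (P : PMF Ω) (ω : Ω) : 0 ≤ wt P ω := ENNReal.toReal_nonneg

theorem sum_wt {Ω : Type*} [Fintype Ω] (P : PMF Ω) : ∑ ω, wt P ω = 1 := by
  have h := P.tsum_coe
  rw [tsum_fintype] at h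
  simp only [wt]
  rw [← ENNReal.toReal_sum fun a _ => P.apply_ne_top a, h, ENNReal.toReal_one]

theorem prob_eq_push {Ω α : Type*} [Fintype Ω] (P : PMF Ω) (A : Ω → α) (a : α) :
    prob P A a = push (wt P) A a := by
  classical
  rw [prob, PMF.map_apply, tsum_fintype, ENNReal.toReal_sum]
  · refine sum_congr rfl fun ω _ => ?_
    by_cases h : A ω = a
    · simp [h, ind, wt]
    · simp [h, Ne.symm h, ind]
  · intro ω _
    split_ifs
    · exact P.apply_ne_top ω
    · simp

theorem sum_push_fst {Ω α β : Type*} [Fintype Ω] [Fintype α] (q : Ω → ℝ) (A : Ω → α)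
    (B : Ω → β) (b : β) : ∑ a, push q (fun ω => (A ω, B ω)) (a, b) = push q B b := by
  simp only [push]
  rw [sum_comm]
  refine sum_congr rfl fun ω _ => ?_
  rw [← mul_sum]
  congr 1
  by_cases h : B ω = b
  · rw [ind_true h, ← sum_ind_eq (A ω)]
    exact sum_congr rfl fun a _ => ind_congr (by simp [h])
  · rw [ind_false h]
    exact sum_eq_zero fun a _ => ind_false (by simp [h])

theorem sum_push_snd {Ω α β : Type*} [Fintype Ω] [Fintype β] (q : Ω → ℝ) (A : Ω → α)
    (B : Ω → β) (a : α) : ∑ b, push q (fun ω => (A ω, B ω)) (a, b) = push q A a := by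
  rw [← sum_push_fst q B A a]
  exact sum_congr rfl fun b _ => sum_congr rfl fun ω _ => by
    congr 1
    exact ind_congr (by simp [and_comm])

variable {X Y W B : Type*} [Fintype X] [Fintype Y]

/-- Conditional entropy, in nats, of the first component given the second. -/
def condEnt (p : X → Y → ℝ) : ℝ := ∑ x, ∑ y, p x y * Real.log ((∑ x', p x' y) / p x y)

/-- Mutual information, in nats, between input and output of the channel `S` with input law `Q`. -/
def info [Fintype W] [Fintype B] (Q : W → ℝ) (S : W → B → ℝ) : ℝ :=
  ∑ w, Q w * ∑ b, S w b * Real.log (S w b / ∑ w', Q w' * S w' b)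

theorem log_two_pos : 0 < Real.log 2 := Real.log_pos (by norm_num)

theorem condEntropy_mul_log_two {Ω : Type*} [Fintype Ω] (P : PMF Ω) (A : Ω → X) (C : Ω → Y) :
    condEntropy P A C * Real.log 2 =
      condEnt fun x y => push (wt P) (fun ω => (A ω, C ω)) (x, y) := by
  simp only [condEntropy, condEnt, prob_eq_push, sum_push_fst, neg_mul, sum_mul, ← sum_neg_distrib]
  refine sum_congr rfl fun x _ => sum_congr rfl fun y _ => ?_
  rw [← inv_div, Real.logb, Real.log_inv]
  field_simp [log_two_pos.ne']

theorem wt_channelLaw [Fintype W] {K : ℕ} {U : Fin K → Type*} (PW : PMF W) (T : W → PMF (∀ k, U k))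
    (s : W × ∀ k, U k) : wt (channelLaw PW T) s = wt PW s.1 * wt (T s.1) s.2 := by
  classical
  obtain ⟨w, t⟩ := s
  simp only [wt, channelLaw, PMF.bind_apply, tsum_fintype]
  rw [← ENNReal.toReal_mul]
  congr 1
  rw [sum_eq_single w]
  · congr 1
    rw [PMF.map_apply, tsum_eq_single t]
    · simp
    · intro t' ht
      simp [Ne.symm ht]
  · intro w' _ hw
    rw [PMF.map_apply]
    simp [Ne.symm hw]
  · simp

variable {K : ℕ} {U : Fin K → Type*} [∀ k, Fintype (U k)]

/-- The channel from `W` to the function `h` of input and output of the channel `T`. -/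
def outputChannel (T : W → PMF (∀ k, U k)) (h : W → (∀ k, U k) → B) (w : W) (b : B) : ℝ :=
  push (wt (T w)) (h w) b

theorem outputChannel_nonneg (T : W → PMF (∀ k, U k)) (h : W → (∀ k, U k) → B) (w : W) (b : B) :
    0 ≤ outputChannel T h w b := push_nonneg (wt_nonneg _) _ _

theorem sum_outputChannel [Fintype B] (T : W → PMF (∀ k, U k)) (h : W → (∀ k, U k) → B) (w : W) :
    ∑ b, outputChannel T h w b = 1 := (sum_push _ _).trans (sum_wt _)

theorem push_channelLaw [Fintype W] (PW : PMF W) (T : W → PMF (∀ k, U k)) (h : W → (∀ k, U k) → B)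
    (w : W) (b : B) :
    push (wt (channelLaw PW T)) (fun s => (s.1, h s.1 s.2)) (w, b) =
      wt PW w * outputChannel T h w b := by
  simp only [push, wt_channelLaw, Fintype.sum_prod_type, outputChannel]
  rw [sum_eq_single w]
  · rw [mul_sum]
    refine sum_congr rfl fun t _ => ?_
    rw [mul_assoc]
    congr 2
    exact ind_congr (by simp)
  · intro w' _ hw
    refine sum_eq_zero fun t _ => ?_
    rw [ind_false (by simp [hw]), mul_zero]
  · simp

/-- The function `h` may depend on the input, so that the pair `(V_k, U_k)` is covered as the output
of a single channel. -/
theorem mutualInfo_channelLaw_mul_log_two [Fintype W] [Fintype B] (PW : PMF W) (T : W → PMF (∀ k, U k))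
    (h : W → (∀ k, U k) → B) :
    mutualInfo (channelLaw PW T) (fun s => s.1) (fun s => h s.1 s.2) * Real.log 2 =
      info (wt PW) (outputChannel T h) := by
  rw [mutualInfo, sub_mul, condEntropy_mul_log_two]
  have hQ : ∀ w, prob (channelLaw PW T) (fun s => s.1) w = wt PW w := by
    intro w
    rw [prob_eq_push, ← sum_push_snd _ _ (fun s : W × _ => h s.1 s.2)]
    simp only [push_channelLaw, ← mul_sum, sum_outputChannel, mul_one]
  simp only [entropy, hQ, condEnt, push_channelLaw, info, neg_mul, sum_mul]
  rw [← sum_neg_distrib, ← sum_sub_distrib]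
  refine sum_congr rfl fun w _ => ?_
  have h1 : wt PW w * Real.logb 2 (wt PW w) * Real.log 2 =
      ∑ b, wt PW w * outputChannel T h w b * Real.log (wt PW w) := by
    rw [← sum_mul, ← mul_sum, sum_outputChannel, mul_one, Real.logb]
    field_simp [log_two_pos.ne']
  rw [h1, ← sum_neg_distrib, ← sum_sub_distrib, mul_sum]
  refine sum_congr rfl fun b _ => ?_
  rcases (wt_nonneg PW w).eq_or_lt with hw | hw
  · simp [← hw]
  rcases (outputChannel_nonneg T h w b).eq_or_lt with hb | hb
  · simp [← hb]
  have hq : 0 < ∑ w', wt PW w' * outputChannel T h w' b :=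
    sum_pos' (fun w' _ => mul_nonneg (wt_nonneg _ _) (outputChannel_nonneg _ _ _ _))
      ⟨w, mem_univ w, mul_pos hw hb⟩
  rw [Real.log_div hq.ne' (mul_pos hw hb).ne', Real.log_div hb.ne' hq.ne',
    Real.log_mul hw.ne' hb.ne']
  ring

variable {V Z : Fin K → Type*} [∀ k, Fintype (Z k)]

/-- The channel from `W` to the observation `U_k` of receiver `k`. -/
def receiverChannel (T : W → PMF (∀ k, U k)) (k : Fin K) : W → U k → ℝ :=
  outputChannel T fun _ t => t k

/-- The channel from `W` to the pair `(V_k, U_k)`. -/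
def genieChannel (T : W → PMF (∀ k, U k)) (φ : ∀ k, W → V k) (k : Fin K) : W → V k × U k → ℝ :=
  outputChannel T fun w t => (φ k w, t k)

/-- The joint law of `(X, Y_k)`. -/
def sourceLaw (P : PMF (X × ∀ k, Z k)) (k : Fin K) (x : X) (y : Z k) : ℝ :=
  push (wt P) (fun z => (z.1, z.2 k)) (x, y)

theorem sourceEquivocation_mul_log_two (P : PMF (X × ∀ k, Z k)) (k : Fin K) :
    sourceEquivocation P k * Real.log 2 = condEnt (sourceLaw P k) :=
  condEntropy_mul_log_two P _ _

/-- The two cuts appear here: `I(W;U) + I(W;V|U) = I(W;V,U)` telescopes from the definitions. -/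
theorem helperBound_mul_log_two [Fintype W] [∀ k, Fintype (V k)] (PW : PMF W)
    (T : W → PMF (∀ k, U k)) (κ : ℚ) (R : Fin K → ℝ) (φ : ∀ k, W → V k) (k : Fin K) :
    helperBound PW T κ R φ k * Real.log 2 =
      min (κ * info (wt PW) (receiverChannel T k) + R k * Real.log 2)
        (κ * info (wt PW) (genieChannel T φ k)) := by
  rw [receiverChannel, genieChannel, ← mutualInfo_channelLaw_mul_log_two,
    ← mutualInfo_channelLaw_mul_log_two, ← mul_assoc, ← mul_assoc, ← add_mul,
    ← min_mul_of_nonneg _ _ log_two_pos.le, helperBound, ← min_add_add_left]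
  congr 3
  simp only [condMutualInfo, mutualInfo]
  ring

end SingleLetter

/-! ### Achievability -/

section Achievability

theorem sum_pi_pairs {ι A B : Type*} [Fintype ι] [DecidableEq ι] [Fintype A] [Fintype B]
    (G : (ι → A) → (ι → B) → ℝ) :
    ∑ z : ι → A × B, G (fun i => (z i).1) (fun i => (z i).2) = ∑ a, ∑ b, G a b := by
  rw [← Fintype.sum_prod_type' G]
  exact Fintype.sum_equiv (Equiv.arrowProdEquivProdArrow ι (fun _ => A) (fun _ => B)) _ _
    fun z => rfl

variable {K : ℕ} {X W B : Type*} {Y U V : Fin K → Type*}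
  [Fintype X] [Fintype W] [Fintype B] [∀ k, Fintype (Y k)] [∀ k, Fintype (U k)]

theorem channel_pair_weight_sum (PW : PMF W) (T : W → PMF (∀ k, U k)) :
    ∑ a : W × ∀ k, U k, wt PW a.1 * wt (T a.1) a.2 = 1 := by
  simp only [Fintype.sum_prod_type, ← mul_sum, sum_wt, mul_one]

/-- The block channel `S` gives the output `b` more than `c` times the likelihood under the
codeword `w` than under a random codeword. -/
def Dense (PW : PMF W) (S : W → B → ℝ) (c : ℝ) {n : ℕ} (w : Fin n → W) (b : Fin n → B) : Prop :=
  c * ∏ j, ∑ w', wt PW w' * S w' (b j) < ∏ j, S (w j) (b j)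

/-- The word `x` has conditional probability above `1 / L` given `y`. -/
def Likely (P : PMF (X × ∀ k, Y k)) (k : Fin K) (L : ℝ) {n : ℕ} (x : Fin n → X)
    (y : Fin n → Y k) : Prop :=
  ∏ i, ∑ x', sourceLaw P k x' (y i) < L * ∏ i, sourceLaw P k (x i) (y i)

/-- Under the joint law of codeword and channel output, the information density per symbol is
unlikely to fall below the mutual information by `δ`. -/
theorem exists_rate_channel (PW : PMF W) (T : W → PMF (∀ k, U k)) (h : W → (∀ k, U k) → B)
    {δ : ℝ} (hδ : 0 < δ) :
    ∃ ρ : ℝ, 0 ≤ ρ ∧ ρ < 1 ∧ ∀ n : ℕ,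
      ∑ w : Fin n → W, (∏ j, wt PW (w j)) * ∑ t : Fin n → ∀ k, U k, (∏ j, wt (T (w j)) (t j)) *
        ind (¬Dense PW (outputChannel T h) (Real.exp (n * (info (wt PW) (outputChannel T h) - δ)))
          w fun j => h (w j) (t j)) ≤ ρ ^ n := by
  have hpos : ∀ a : W × ∀ k, U k, 0 < wt PW a.1 * wt (T a.1) a.2 →
      0 < wt PW a.1 ∧ 0 < outputChannel T h a.1 (h a.1 a.2) := by
    intro a ha
    have h1 : 0 < wt PW a.1 := lt_of_le_of_ne (wt_nonneg _ _) fun h0 => by simp [← h0] at ha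
    exact ⟨h1, push_pos (wt_nonneg _) (h a.1) (pos_of_mul_pos_right ha h1.le)⟩
  obtain ⟨ρ, h0, h1, hρ⟩ := exists_rate_likelihood_le
    (r := fun a : W × ∀ k, U k => wt PW a.1 * wt (T a.1) a.2)
    (f := fun a => outputChannel T h a.1 (h a.1 a.2))
    (g := fun a => ∑ w', wt PW w' * outputChannel T h w' (h a.1 a.2))
    (t := info (wt PW) (outputChannel T h) - δ)
    (fun a => mul_nonneg (wt_nonneg _ _) (wt_nonneg _ _)) (channel_pair_weight_sum PW T)
    (fun a ha => (hpos a ha).2)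
    (fun a ha => sum_pos' (fun w' _ => mul_nonneg (wt_nonneg _ _) (outputChannel_nonneg _ _ _ _))
      ⟨a.1, mem_univ _, mul_pos (hpos a ha).1 (hpos a ha).2⟩) (by
      have : ∑ a : W × ∀ k, U k, wt PW a.1 * wt (T a.1) a.2 *
          Real.log (outputChannel T h a.1 (h a.1 a.2) /
            ∑ w', wt PW w' * outputChannel T h w' (h a.1 a.2)) =
          info (wt PW) (outputChannel T h) := by
        simp only [Fintype.sum_prod_type, info, mul_assoc, ← mul_sum]
        refine sum_congr rfl fun w _ => ?_
        congr 1
        exact (sum_push_mul (wt (T w)) (h w) (fun b => Real.log (outputChannel T h w b /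
          ∑ w', wt PW w' * outputChannel T h w' b))).symm
      rw [this]; linarith)
  refine ⟨ρ, h0, h1, fun n => le_trans (le_of_eq ?_) (hρ n)⟩
  simp only [Dense, mul_sum, not_lt, prod_mul_distrib, mul_assoc]
  exact (sum_pi_pairs (fun (w : Fin n → W) (t : Fin n → ∀ k, U k) =>
    (∏ j, wt PW (w j)) * ((∏ j, wt (T (w j)) (t j)) *
      ind (∏ j, outputChannel T h (w j) (h (w j) (t j)) ≤
        Real.exp (n * (info (wt PW) (outputChannel T h) - δ)) *
            ∏ j, ∑ w', wt PW w' * outputChannel T h w' (h (w j) (t j)))))).symm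

theorem block_independent_exceeds_le (PW : PMF W) (T : W → PMF (∀ k, U k))
    (h : W → (∀ k, U k) → B) (n : ℕ) {c : ℝ} (hc : 0 < c) :
    ∑ w : Fin n → W, (∏ j, wt PW (w j)) * ∑ t : Fin n → ∀ k, U k, (∏ j, wt (T (w j)) (t j)) *
      ∑ v : Fin n → W, (∏ j, wt PW (v j)) *
        ind (Dense PW (outputChannel T h) c v fun j => h (w j) (t j)) ≤ c⁻¹ := by
  simp only [Dense]
  refine le_trans (le_of_eq ?_) (independent_exceeds_le
    (Q := fun w : Fin n → W => ∏ j, wt PW (w j))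
    (S := fun (w : Fin n → W) (b : Fin n → B) => ∏ j, outputChannel T h (w j) (b j))
    (fun w => prod_nonneg fun j _ => wt_nonneg _ _)
    (sum_pi_prod_eq_one (f := fun _ : Fin n => wt PW) fun _ => sum_wt _)
    (fun w b => prod_nonneg fun j _ => outputChannel_nonneg _ _ _ _)
    (fun w => sum_pi_prod_eq_one (f := fun j => outputChannel T h (w j))
      fun j => sum_outputChannel _ _ _) hc)
  refine sum_congr rfl fun w _ => ?_
  congr 1
  have hq : ∀ b : Fin n → B, ∑ v : Fin n → W, (∏ j, wt PW (v j)) *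
      ∏ j, outputChannel T h (v j) (b j) = ∏ j, ∑ w', wt PW w' * outputChannel T h w' (b j) := by
    intro b
    simp only [← prod_mul_distrib]
    exact sum_pi_prod (fun j w' => wt PW w' * outputChannel T h w' (b j))
  simp only [hq]
  exact (sum_pi_push (fun j => wt (T (w j))) (fun j => h (w j)) (fun b =>
    ∑ v : Fin n → W, (∏ j, wt PW (v j)) *
        ind (c * ∏ j, ∑ w', wt PW w' * outputChannel T h w' (b j) <
          ∏ j, outputChannel T h (v j) (b j)))).symm

theorem sourceLaw_nonneg (P : PMF (X × ∀ k, Y k)) (k : Fin K) (x : X) (y : Y k) :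
    0 ≤ sourceLaw P k x y := push_nonneg (wt_nonneg _) _ _

theorem exists_rate_source (P : PMF (X × ∀ k, Y k)) (k : Fin K) {δ : ℝ} (hδ : 0 < δ) :
    ∃ ρ : ℝ, 0 ≤ ρ ∧ ρ < 1 ∧ ∀ n : ℕ,
      ∑ z : Fin n → X × ∀ k, Y k, (∏ i, wt P (z i)) *
        ind (¬Likely P k (Real.exp (n * (condEnt (sourceLaw P k) + δ)))
          (fun i => (z i).1) fun i => (z i).2 k) ≤ ρ ^ n := by
  have hpos : ∀ z, 0 < wt P z → 0 < sourceLaw P k z.1 (z.2 k) := fun z hz =>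
    push_pos (wt_nonneg P) (fun z => (z.1, z.2 k)) hz
  have hpos' : ∀ z, 0 < wt P z → 0 < ∑ x', sourceLaw P k x' (z.2 k) := fun z hz =>
    sum_pos' (fun x' _ => sourceLaw_nonneg _ _ _ _) ⟨z.1, mem_univ _, hpos z hz⟩
  obtain ⟨ρ, h0, h1, hρ⟩ := exists_rate_likelihood_le (r := wt P)
    (f := fun z => sourceLaw P k z.1 (z.2 k)) (g := fun z => ∑ x', sourceLaw P k x' (z.2 k))
    (t := -(condEnt (sourceLaw P k) + δ)) (wt_nonneg P) (sum_wt P) hpos hpos' (by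
      have : ∑ z, wt P z * Real.log (sourceLaw P k z.1 (z.2 k) / ∑ x', sourceLaw P k x' (z.2 k)) =
          -condEnt (sourceLaw P k) := by
        have h2 := sum_push_mul (wt P) (fun z => (z.1, z.2 k)) (fun b : X × Y k =>
          Real.log (sourceLaw P k b.1 b.2 / ∑ x', sourceLaw P k x' b.2))
        rw [← h2, Fintype.sum_prod_type, condEnt, ← sum_neg_distrib]
        refine sum_congr rfl fun x _ => ?_
        rw [← sum_neg_distrib]
        refine sum_congr rfl fun y _ => ?_
        rw [← inv_div, Real.log_inv, mul_neg]
        rfl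
      rw [this]; linarith)
  refine ⟨ρ, h0, h1, fun n => le_trans (le_of_eq ?_) (hρ n)⟩
  refine sum_congr rfl fun z _ => ?_
  congr 1
  refine ind_congr ?_
  rw [Likely, not_lt, mul_neg, Real.exp_neg, inv_mul_eq_div, le_div_iff₀ (Real.exp_pos _), mul_comm]

theorem numMessages_pos (n : ℕ) {r : ℝ} (hr : 0 ≤ r) : 0 < numMessages n r :=
  Nat.floor_pos.2 (Real.one_le_rpow (by norm_num) (by positivity))

/-- Rounding down a number that is at least one loses less than a factor two. -/
theorem inv_numMessages_le (n : ℕ) {r : ℝ} (hr : 0 ≤ r) :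
    (numMessages n r : ℝ)⁻¹ ≤ 2 * Real.exp (-(n * (r * Real.log 2))) := by
  have h1 : (1 : ℝ) ≤ numMessages n r := by exact_mod_cast numMessages_pos n hr
  have h2 : (2 : ℝ) ^ ((n : ℝ) * r) < numMessages n r + 1 := Nat.lt_floor_add_one _
  have h3 : Real.exp (n * (r * Real.log 2)) = (2 : ℝ) ^ ((n : ℝ) * r) := by
    rw [Real.rpow_def_of_pos (by norm_num)]; congr 1; ring
  rw [Real.exp_neg, h3, ← div_eq_mul_inv, inv_eq_one_div, div_le_div_iff₀ (by linarith)
    (by positivity)]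
  linarith

theorem eventually_mul_pow_le {ρ : ℝ} (h0 : 0 ≤ ρ) (h1 : ρ < 1) (c : ℝ) {ε : ℝ} (hε : 0 < ε) :
    ∃ N : ℕ, ∀ n ≥ N, c * ρ ^ n ≤ ε := by
  have h := (tendsto_pow_atTop_nhds_zero_of_lt_one h0 h1).const_mul c
  rw [mul_zero] at h
  exact Filter.eventually_atTop.1 (h.eventually_le_const hε)

theorem card_block_likely_le (P : PMF (X × ∀ k, Y k)) (k : Fin K) {L : ℝ} (hL : 0 ≤ L) {n : ℕ}
    (y : Fin n → Y k) : ∑ x : Fin n → X, ind (Likely P k L x y) ≤ L := by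
  have hs : ∏ i, ∑ x', sourceLaw P k x' (y i) =
      ∑ x : Fin n → X, ∏ i, sourceLaw P k (x i) (y i) :=
    (sum_pi_prod fun i x' => sourceLaw P k x' (y i)).symm
  simp only [Likely, hs]
  exact card_likely_le (p := fun x : Fin n → X => ∏ i, sourceLaw P k (x i) (y i))
    (fun x => prod_nonneg fun i _ => sourceLaw_nonneg _ _ _ _) hL

theorem block_failure_average_le (P : PMF (X × ∀ k, Y k)) (T : W → PMF (∀ k, U k))
    [DecidableEq X] [∀ k, Fintype (V k)] (φ : ∀ k, W → V k) (PW : PMF W) (k : Fin K)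
    (ns nc M : ℕ) {L t₁ t₂ : ℝ} (hL : 0 ≤ L) (ht₁ : 0 < t₁) (ht₂ : 0 < t₂) :
    ∑ F : (Fin ns → X) → (Fin nc → W), (∏ x, ∏ j, wt PW (F x j)) *
      ∑ z : Fin ns → X × ∀ k, Y k, ∑ t : Fin nc → ∀ k, U k,
        (∏ i, wt P (z i)) * (∏ j, wt (T (F (fun i => (z i).1) j)) (t j)) *
        failureBound M F (fun w j => φ k (w j)) (Likely P k L)
          (Dense PW (receiverChannel T k) t₁)
          (fun w b => Dense PW (genieChannel T φ k) t₂ w fun j => (b.1 j, b.2 j))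
          (fun i => (z i).1) (fun i => (z i).2 k) (fun j => t j k) ≤
    ∑ z : Fin ns → X × ∀ k, Y k, (∏ i, wt P (z i)) *
        ind (¬Likely P k L (fun i => (z i).1) fun i => (z i).2 k) +
      ∑ w : Fin nc → W, (∏ j, wt PW (w j)) * ∑ t : Fin nc → ∀ k, U k, (∏ j, wt (T (w j)) (t j)) *
        ind (¬Dense PW (receiverChannel T k) t₁ w fun j => t j k) +
      ∑ w : Fin nc → W, (∏ j, wt PW (w j)) * ∑ t : Fin nc → ∀ k, U k, (∏ j, wt (T (w j)) (t j)) *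
        ind (¬Dense PW (genieChannel T φ k) t₂ w fun j => (φ k (w j), t j k)) +
      L * ((M : ℝ)⁻¹ * t₁⁻¹ + t₂⁻¹) := by
  have i₁ := block_independent_exceeds_le PW T (fun _ t => t k) nc ht₁
  have i₂ := block_independent_exceeds_le PW T (fun w t => (φ k w, t k)) nc ht₂
  have hp1 : ∑ z : Fin ns → X × ∀ k, Y k, ∏ i, wt P (z i) = 1 :=
    sum_pi_prod_eq_one (f := fun _ : Fin ns => wt P) fun _ => sum_wt _
  have hQ1 : ∑ w : Fin nc → W, ∏ j, wt PW (w j) = 1 :=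
    sum_pi_prod_eq_one (f := fun _ : Fin nc => wt PW) fun _ => sum_wt _
  have hS1 : ∀ w : Fin nc → W, ∑ t : Fin nc → ∀ k, U k, ∏ j, wt (T (w j)) (t j) = 1 := fun w =>
    sum_pi_prod_eq_one (f := fun j => wt (T (w j))) fun _ => sum_wt _
  have hp : ∀ z : Fin ns → X × ∀ k, Y k, 0 ≤ ∏ i, wt P (z i) := fun z =>
    prod_nonneg fun i _ => wt_nonneg _ _
  exact codebook_average_le M
    (fun (z : Fin ns → X × ∀ k, Y k) (i : Fin ns) => (z i).1)
    (fun (z : Fin ns → X × ∀ k, Y k) (i : Fin ns) => (z i).2 k)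
    (fun (t : Fin nc → ∀ k, U k) (j : Fin nc) => t j k)
    (fun (w : Fin nc → W) (j : Fin nc) => φ k (w j))
    hp hp1 hS1 hQ1 (Likely P k L) (Dense PW (receiverChannel T k) t₁)
    (fun w b => Dense PW (genieChannel T φ k) t₂ w fun j => (b.1 j, b.2 j))
    (inv_nonneg.2 ht₁.le) (inv_nonneg.2 ht₂.le) (card_block_likely_le P k hL) i₁ i₂

/-- Random coding for a single receiver: the average over the random codebook of the failure bound
is arbitrarily small. -/
theorem exists_small_failure_average (P : PMF (X × ∀ k, Y k)) (T : W → PMF (∀ k, U k))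
    [DecidableEq X] [∀ k, Fintype (V k)] {κ : ℚ} (hκ : 0 < κ) {R : Fin K → ℝ} (φ : ∀ k, W → V k)
    (PW : PMF W) (k : Fin K) (hR : 0 ≤ R k)
    (h₁ : condEnt (sourceLaw P k) <
      κ * info (wt PW) (receiverChannel T k) + R k * Real.log 2)
    (h₂ : condEnt (sourceLaw P k) < κ * info (wt PW) (genieChannel T φ k))
    {ε : ℝ} (hε : 0 < ε) :
    ∃ N : ℕ, ∀ ns nc : ℕ, N ≤ ns → N ≤ nc → (nc : ℚ) / (ns : ℚ) = κ →
      ∃ (ok : (Fin ns → X) → (Fin ns → Y k) → Prop) (A₁ : (Fin nc → W) → (Fin nc → U k) → Prop)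
        (A₂ : (Fin nc → W) → (Fin nc → V k) × (Fin nc → U k) → Prop),
        ∑ F : (Fin ns → X) → (Fin nc → W), (∏ x, ∏ j, wt PW (F x j)) *
          ∑ z : Fin ns → X × ∀ k, Y k, ∑ t : Fin nc → ∀ k, U k,
            (∏ i, wt P (z i)) * (∏ j, wt (T (F (fun i => (z i).1) j)) (t j)) *
            failureBound (numMessages ns (R k)) F (fun w j => φ k (w j)) ok A₁ A₂
              (fun i => (z i).1) (fun i => (z i).2 k) (fun j => t j k) ≤ ε := by
  set H := condEnt (sourceLaw P k) with hH
  set J₁ := info (wt PW) (receiverChannel T k) with hJ₁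
  set J₂ := info (wt PW) (genieChannel T φ k) with hJ₂
  have hκ' : (0 : ℝ) < κ := by exact_mod_cast hκ
  obtain ⟨δ, hδ, hδ₁, hδ₂⟩ : ∃ δ : ℝ, 0 < δ ∧ 0 < κ * (J₁ - δ) + R k * Real.log 2 - (H + δ) ∧
      0 < κ * (J₂ - δ) - (H + δ) := by
    set g := min (κ * J₁ + R k * Real.log 2 - H) (κ * J₂ - H) with hg
    have hgpos : 0 < g := lt_min (by linarith) (by linarith)
    -- Lowering the information by `δ` costs `κ δ` and raising the entropy costs `δ`; together they
    -- consume half of the gap `g`.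
    refine ⟨g / (2 * (κ + 1)), by positivity, ?_, ?_⟩
    · have := min_le_left (κ * J₁ + R k * Real.log 2 - H) (κ * J₂ - H)
      have e : (κ + 1) * (g / (2 * (κ + 1))) = g / 2 := by field_simp
      linarith
    · have := min_le_right (κ * J₁ + R k * Real.log 2 - H) (κ * J₂ - H)
      have e : (κ + 1) * (g / (2 * (κ + 1))) = g / 2 := by field_simp
      linarith
  set η₁ := κ * (J₁ - δ) + R k * Real.log 2 - (H + δ) with hη₁
  set η₂ := κ * (J₂ - δ) - (H + δ) with hη₂
  obtain ⟨ρ₀, a₀, b₀, c₀⟩ := exists_rate_source P k hδ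
  obtain ⟨ρ₁, a₁, b₁, c₁⟩ := exists_rate_channel PW T (fun _ t => t k) hδ
  obtain ⟨ρ₂, a₂, b₂, c₂⟩ := exists_rate_channel PW T (fun w t => (φ k w, t k)) hδ
  -- Five contributions: one atypical source, two atypical channel events, two kinds of competitor.
  have hε5 : 0 < ε / 5 := by positivity
  obtain ⟨N₀, hN₀⟩ := eventually_mul_pow_le a₀ b₀ 1 hε5
  obtain ⟨N₁, hN₁⟩ := eventually_mul_pow_le a₁ b₁ 1 hε5
  obtain ⟨N₂, hN₂⟩ := eventually_mul_pow_le a₂ b₂ 1 hε5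
  obtain ⟨N₃, hN₃⟩ := eventually_mul_pow_le (Real.exp_pos (-η₁)).le
    (Real.exp_lt_one_iff.2 (by linarith)) 2 hε5
  obtain ⟨N₄, hN₄⟩ := eventually_mul_pow_le (Real.exp_pos (-η₂)).le
    (Real.exp_lt_one_iff.2 (by linarith)) 1 hε5
  refine ⟨max N₀ (max N₁ (max N₂ (max N₃ N₄))), fun ns nc hns hnc hratio => ?_⟩
  simp only [max_le_iff] at hns hnc
  have hncκ : (nc : ℝ) = κ * ns := by
    -- Division by zero yields zero, which is not the positive ratio `κ`.
    have hns0 : (ns : ℚ) ≠ 0 := by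
      rintro h0
      rw [h0, div_zero] at hratio
      exact hκ.ne hratio
    have := (div_eq_iff hns0).1 hratio
    exact_mod_cast this
  let L : ℝ := Real.exp (ns * (H + δ))
  let t₁ : ℝ := Real.exp (nc * (J₁ - δ))
  let t₂ : ℝ := Real.exp (nc * (J₂ - δ))
  refine ⟨Likely P k L, Dense PW (receiverChannel T k) t₁,
    fun w b => Dense PW (genieChannel T φ k) t₂ w fun j => (b.1 j, b.2 j),
    (block_failure_average_le P T φ PW k ns nc _ (Real.exp_pos _).le (Real.exp_pos _)
      (Real.exp_pos _)).trans ?_⟩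
  have e₀ := (c₀ ns).trans ((one_mul (ρ₀ ^ ns)).ge.trans (hN₀ ns hns.1))
  have e₁ := (c₁ nc).trans ((one_mul (ρ₁ ^ nc)).ge.trans (hN₁ nc hnc.2.1))
  have e₂ := (c₂ nc).trans ((one_mul (ρ₂ ^ nc)).ge.trans (hN₂ nc hnc.2.2.1))
  have e₃ : L * ((numMessages ns (R k) : ℝ)⁻¹ * t₁⁻¹) ≤ ε / 5 := by
    refine le_trans ?_ (hN₃ ns hns.2.2.2.1)
    calc L * ((numMessages ns (R k) : ℝ)⁻¹ * t₁⁻¹)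
        ≤ L * (2 * Real.exp (-(ns * (R k * Real.log 2))) * t₁⁻¹) := by
          refine mul_le_mul_of_nonneg_left (mul_le_mul_of_nonneg_right
            (inv_numMessages_le ns hR) (inv_nonneg.2 (Real.exp_pos _).le)) (Real.exp_pos _).le
      _ = 2 * Real.exp (-η₁) ^ ns := by
          simp only [L, t₁]
          rw [← Real.exp_neg, ← Real.exp_nat_mul, hncκ, mul_assoc, ← Real.exp_add,
            mul_left_comm, ← Real.exp_add]
          congr 2
          rw [hη₁]; ring
  have e₄ : L * t₂⁻¹ ≤ ε / 5 := by
    refine le_trans (le_of_eq ?_) (hN₄ ns hns.2.2.2.2)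
    simp only [L, t₂]
    rw [← Real.exp_neg, ← Real.exp_nat_mul, hncκ, one_mul, ← Real.exp_add]
    congr 1
    rw [hη₂]; ring
  have e₅ : L * ((numMessages ns (R k) : ℝ)⁻¹ * t₁⁻¹ + t₂⁻¹) ≤ ε / 5 + ε / 5 := by
    rw [mul_add]; exact add_le_add e₃ e₄
  refine (add_le_add (add_le_add (add_le_add e₀ e₁) e₂) e₅).trans (le_of_eq ?_)
  ring

theorem Code.errorProb_eq {W : Type*} {ns nc : ℕ} {R : Fin K → ℝ} (c : Code X W Y U V ns nc R)
    (P : PMF (X × ∀ k, Y k)) (T : W → PMF (∀ k, U k)) (φ : ∀ k, W → V k) (k : Fin K) :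
    c.errorProb P T φ k = ∑ z : Fin ns → X × ∀ k, Y k, ∑ t : Fin nc → ∀ k, U k,
      (∏ i, wt P (z i)) * (∏ j, wt (T (c.enc (fun i => (z i).1) j)) (t j)) *
        ind (c.reconstruct φ k (fun i => (z i).1) (fun i => (z i).2 k) (fun j => t j k) ≠
          fun i => (z i).1) := by
  refine sum_congr rfl fun z _ => sum_congr rfl fun t _ => ?_
  by_cases h : c.reconstruct φ k (fun i => (z i).1) (fun i => (z i).2 k) (fun j => t j k) ≠
      fun i => (z i).1
  · rw [if_pos h, ind_true h, mul_one]; rfl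
  · rw [if_neg h, ind_false h, mul_zero]

theorem failureBound_nonneg {𝒳 𝒴 𝒲 𝒰 𝒱 : Type*} [Fintype 𝒳] (M : ℕ) (F : 𝒳 → 𝒲) (φ : 𝒲 → 𝒱)
    (ok : 𝒳 → 𝒴 → Prop) (A₁ : 𝒲 → 𝒰 → Prop) (A₂ : 𝒲 → 𝒱 × 𝒰 → Prop) (x : 𝒳) (y : 𝒴) (u : 𝒰) :
    0 ≤ failureBound M F φ ok A₁ A₂ x y u :=
  add_nonneg (add_nonneg (add_nonneg (ind_nonneg _) (ind_nonneg _)) (ind_nonneg _))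
    (sum_nonneg fun x' _ => mul_nonneg (mul_nonneg (ind_nonneg _) (ind_nonneg _))
      (add_nonneg (mul_nonneg (by positivity) (ind_nonneg _)) (ind_nonneg _)))

theorem achievable_of_lt [∀ k, Fintype (V k)] (P : PMF (X × ∀ k, Y k)) (T : W → PMF (∀ k, U k))
    {κ : ℚ} (hκ : 0 < κ) {R : Fin K → ℝ} (hR : ∀ k, 0 ≤ R k) (φ : ∀ k, W → V k) (PW : PMF W)
    (h₁ : ∀ k, condEnt (sourceLaw P k) <
      κ * info (wt PW) (receiverChannel T k) + R k * Real.log 2)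
    (h₂ : ∀ k, condEnt (sourceLaw P k) < κ * info (wt PW) (genieChannel T φ k)) :
    Achievable P T κ R φ := by
  classical
  intro ε hε
  -- The `K` averages must add up to at most `ε`; `K + 1` also allows for no receivers.
  have hε' : 0 < ε / (K + 1) := by positivity
  choose N hN using fun k =>
    exists_small_failure_average P T hκ φ PW k (hR k) (h₁ k) (h₂ k) hε'
  refine ⟨univ.sup N, fun ns nc hns hnc hratio => ?_⟩
  choose ok A₁ A₂ hA using fun k => hN k ns nc ((le_sup (mem_univ k)).trans hns)
    ((le_sup (mem_univ k)).trans hnc) hratio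
  have hX : Nonempty X := ⟨P.support_nonempty.some.1⟩
  let E : Fin K → ((Fin ns → X) → (Fin nc → W)) → ℝ := fun k F =>
    ∑ z : Fin ns → X × ∀ k, Y k, ∑ t : Fin nc → ∀ k, U k,
      (∏ i, wt P (z i)) * (∏ j, wt (T (F (fun i => (z i).1) j)) (t j)) *
        failureBound (numMessages ns (R k)) F (fun w j => φ k (w j)) (ok k) (A₁ k) (A₂ k)
          (fun i => (z i).1) (fun i => (z i).2 k) (fun j => t j k)
  have hr : ∀ (F : (Fin ns → X) → (Fin nc → W)) (z : Fin ns → X × ∀ k, Y k)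
      (t : Fin nc → ∀ k, U k),
      0 ≤ (∏ i, wt P (z i)) * (∏ j, wt (T (F (fun i => (z i).1) j)) (t j)) := fun F z t =>
    mul_nonneg (prod_nonneg fun i _ => wt_nonneg _ _) (prod_nonneg fun i _ => wt_nonneg _ _)
  have hE0 : ∀ k F, 0 ≤ E k F := fun k F =>
    sum_nonneg fun z _ => sum_nonneg fun t _ =>
      mul_nonneg (hr F z t) (failureBound_nonneg _ _ _ _ _ _ _ _ _)
  obtain ⟨F, hF⟩ := exists_le_of_average_le
    (w := fun F : (Fin ns → X) → (Fin nc → W) => ∏ x, ∏ j, wt PW (F x j))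
    (f := fun F => ∑ k, E k F) (c := ε)
    (fun F => prod_nonneg fun x _ => prod_nonneg fun j _ => wt_nonneg _ _)
    (sum_pi_prod_eq_one (f := fun (_ : Fin ns → X) (w : Fin nc → W) => ∏ j, wt PW (w j)) fun _ =>
      sum_pi_prod_eq_one (f := fun _ : Fin nc => wt PW) fun _ => sum_wt _) (by
      simp only [mul_sum (s := (univ : Finset (Fin K)))]
      rw [sum_comm]
      refine (sum_le_sum fun k _ => hA k).trans ?_
      rw [sum_const, card_univ, Fintype.card_fin, nsmul_eq_mul, mul_div_assoc', div_le_iff₀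
        (by positivity)]
      nlinarith)
  -- The common codebook `F` is now fixed; helper and decoder are chosen separately for each
  -- receiver.
  choose f g hfg using fun k => exists_binning (numMessages_pos ns (hR k))
    (fun (z : Fin ns → X × ∀ k, Y k) i => (z i).1) (fun z i => (z i).2 k)
    (fun (t : Fin nc → ∀ k, U k) j => t j k) F (fun w j => φ k (w j)) (hr F)
    (ok k) (A₁ k) (A₂ k)
  refine ⟨⟨F, f, g⟩, fun k => ?_⟩
  rw [Code.errorProb_eq]
  exact (hfg k).trans ((single_le_sum (fun k _ => hE0 k F) (mem_univ k)).trans hF)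

end Achievability

/-! ### Converse -/

section Converse

/-- One-shot converse, for an arbitrary output law `q`. -/
theorem condEnt_le_of_decoder {𝒳 𝒴 ℬ C : Type*} [Fintype 𝒳] [Fintype 𝒴] [Fintype ℬ] [Fintype C]
    {p : 𝒳 → 𝒴 → ℝ} (hp : ∀ x y, 0 ≤ p x y) (hp1 : ∑ x, ∑ y, p x y = 1)
    {S : 𝒳 → ℬ → ℝ} (hS : ∀ x b, 0 ≤ S x b) (hS1 : ∀ x, ∑ b, S x b = 1)
    {q : ℬ → ℝ} (hq : ∀ b, 0 ≤ q b) (hq1 : ∑ b, q b = 1)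
    (hac : ∀ x y b, 0 < p x y → 0 < S x b → 0 < q b) (m : 𝒳 → C) (g : ℬ → 𝒴 → C → 𝒳) :
    condEnt p ≤ (∑ x, ∑ y, p x y * ∑ b, S x b * Real.log (S x b / q b)) +
      Real.log (Fintype.card C) + Real.log 2 +
      (∑ x, ∑ y, ∑ b, p x y * S x b * ind (g b y (m x) ≠ x)) * Real.log (Fintype.card 𝒳) := by
  have hX : Nonempty 𝒳 := by
    by_contra h
    rw [not_nonempty_iff] at h
    simp at hp1
  have hC : Nonempty C := hX.map m
  set N : ℝ := (Fintype.card 𝒳 : ℝ) with hN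
  set M : ℝ := (Fintype.card C : ℝ) with hM
  have hN1 : 1 ≤ N := by rw [hN]; exact_mod_cast Fintype.card_pos
  have hM1 : 1 ≤ M := by rw [hM]; exact_mod_cast Fintype.card_pos
  let pY : 𝒴 → ℝ := fun y => ∑ x, p x y
  have hpY : ∀ y, 0 ≤ pY y := fun y => sum_nonneg fun x _ => hp x y
  -- Half the weight sits on correctly decoded words, half is uniform. For given `y` and `b` at most
  -- one word per message is decoded correctly, so the sum over `x` is at most `M / 2 + 1 / 2 ≤ M`.
  -- The uniform half keeps the logarithm finite on errors, at a cost of `log N`.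
  let s : 𝒳 → 𝒴 → ℬ → ℝ := fun x y b => ind (g b y (m x) = x) / 2 + 1 / (2 * N)
  have hs0 : ∀ x y b, 0 < s x y b := fun x y b =>
    add_pos_of_nonneg_of_pos (div_nonneg (ind_nonneg _) (by norm_num)) (by positivity)
  have hsum : ∀ y b, ∑ x, s x y b ≤ M := by
    intro y b
    have h1 : ∑ x, ind (g b y (m x) = x) ≤ M := by
      calc ∑ x, ind (g b y (m x) = x) ≤ ∑ x, ∑ c, ind (g b y c = x) :=
            sum_le_sum fun x _ => single_le_sum (f := fun c => ind (g b y c = x))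
              (fun c _ => ind_nonneg _) (mem_univ (m x))
        _ = M := by
            rw [sum_comm]; simp only [sum_ind_eq, sum_const, card_univ, nsmul_eq_mul, mul_one, hM]
    simp only [s, sum_add_distrib, ← sum_div, sum_const, card_univ, nsmul_eq_mul, ← hN]
    have : N * 1 / (2 * N) = 1 / 2 := by field_simp
    linarith
  have key : ∀ x y b, p x y * S x b * Real.log (pY y / p x y) ≤
      p x y * (S x b * Real.log (S x b / q b)) + p x y * S x b * Real.log M +
      p x y * S x b * Real.log 2 + p x y * S x b * ind (g b y (m x) ≠ x) * Real.log N +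
      (pY y * q b * s x y b / M - p x y * S x b) := by
    intro x y b
    have hQ : 0 ≤ pY y * q b * s x y b / M :=
      div_nonneg (mul_nonneg (mul_nonneg (hpY y) (hq b)) (hs0 x y b).le) (by linarith)
    rcases (hp x y).eq_or_lt with h | h
    · simp only [← h, zero_mul, zero_add, sub_zero]; exact hQ
    rcases (hS x b).eq_or_lt with h' | h'
    · simp only [← h', zero_mul, mul_zero, zero_add, sub_zero]; exact hQ
    have hq' := hac x y b h h'
    have hpY' : 0 < pY y := lt_of_lt_of_le h
      (single_le_sum (f := fun x => p x y) (fun x _ => hp x y) (mem_univ x))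
    have hr : 0 < p x y * S x b := mul_pos h h'
    -- Gibbs' inequality, pointwise, for the true law `p x y * S x b` against the subprobability `pY
    -- y * q b * s x y b / M`.
    have hlog := Real.log_le_sub_one_of_pos
      (x := pY y * q b * s x y b / M / (p x y * S x b)) (by have := hs0 x y b; positivity)
    have hM0 : M ≠ 0 := by linarith
    rw [Real.log_div (div_ne_zero (mul_ne_zero (mul_ne_zero hpY'.ne' hq'.ne') (hs0 x y b).ne') hM0)
      hr.ne', Real.log_div (mul_ne_zero (mul_ne_zero hpY'.ne' hq'.ne') (hs0 x y b).ne') hM0,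
      Real.log_mul (mul_ne_zero hpY'.ne' hq'.ne') (hs0 x y b).ne',
      Real.log_mul hpY'.ne' hq'.ne', Real.log_mul h.ne' h'.ne'] at hlog
    have hs : -(Real.log 2 + ind (g b y (m x) ≠ x) * Real.log N) ≤ Real.log (s x y b) := by
      by_cases hg : g b y (m x) = x
      · rw [ind_false (not_not.2 hg), zero_mul, add_zero, ← Real.log_inv]
        refine Real.log_le_log (by norm_num) ?_
        have : 0 < 1 / (2 * N) := by positivity
        simp only [s, ind_true hg]
        linarith
      · rw [ind_true hg, one_mul, ← Real.log_mul (by norm_num) (by linarith), ← Real.log_inv]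
        refine Real.log_le_log (by positivity) ?_
        simp only [s, ind_false hg]
        rw [zero_div, zero_add, one_div]
    rw [Real.log_div hpY'.ne' h.ne', Real.log_div h'.ne' hq'.ne']
    have h3 := add_le_add (mul_le_mul_of_nonneg_left hlog hr.le)
      (mul_le_mul_of_nonneg_left hs hr.le)
    have h4 : p x y * S x b * (pY y * q b * s x y b / M / (p x y * S x b)) =
        pY y * q b * s x y b / M := by field_simp
    have h5 : p x y * S x b * (pY y * q b * s x y b / M / (p x y * S x b) - 1) =
        pY y * q b * s x y b / M - p x y * S x b := by rw [mul_sub, h4, mul_one]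
    rw [h5] at h3
    linarith
  have hsumQ : ∑ x, ∑ y, ∑ b, pY y * q b * s x y b / M ≤ 1 := by
    calc ∑ x, ∑ y, ∑ b, pY y * q b * s x y b / M
        = ∑ y, ∑ b, pY y * q b * ((∑ x, s x y b) / M) := by
          rw [sum_comm]
          refine sum_congr rfl fun y _ => ?_
          rw [sum_comm]
          refine sum_congr rfl fun b _ => ?_
          rw [sum_div, mul_sum]
          exact sum_congr rfl fun x _ => by ring
      _ ≤ ∑ y, ∑ b, pY y * q b * 1 := by
          refine sum_le_sum fun y _ => sum_le_sum fun b _ =>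
            mul_le_mul_of_nonneg_left ?_ (mul_nonneg (hpY y) (hq b))
          exact div_le_one_of_le₀ (hsum y b) (by linarith)
      _ = 1 := by
          simp only [mul_one, ← mul_sum, hq1, pY]
          rw [sum_comm]; exact hp1
  have htot := sum_le_sum fun x (_ : x ∈ univ) => sum_le_sum fun y (_ : y ∈ univ) =>
    sum_le_sum fun b (_ : b ∈ univ) => key x y b
  simp only [sum_add_distrib, sum_sub_distrib, ← sum_mul, ← mul_sum, hS1, mul_one, hp1,
    one_mul] at htot
  have hY : condEnt p = ∑ x, ∑ y, p x y * Real.log (pY y / p x y) := rfl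
  rw [hY]
  simp only [← sum_mul]
  linarith

theorem condEnt_block {X Y : Type*} [Fintype X] [Fintype Y] {p : X → Y → ℝ}
    (hp : ∀ x y, 0 ≤ p x y) (hp1 : ∑ x, ∑ y, p x y = 1) (n : ℕ) :
    condEnt (fun (x : Fin n → X) (y : Fin n → Y) => ∏ i, p (x i) (y i)) = n * condEnt p := by
  have h1 : ∀ (x : Fin n → X) (y : Fin n → Y), (∏ i, p (x i) (y i)) *
      Real.log ((∑ x' : Fin n → X, ∏ i, p (x' i) (y i)) / ∏ i, p (x i) (y i)) =
      (∏ i, p (x i) (y i)) * ∑ i, Real.log ((∑ x', p x' (y i)) / p (x i) (y i)) := by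
    intro x y
    by_cases h : ∏ i, p (x i) (y i) = 0
    · simp [h]
    replace h := Finset.prod_ne_zero_iff.1 h
    rw [sum_pi_prod (fun i x' => p x' (y i)), ← prod_div_distrib, Real.log_prod]
    intro i hi
    refine div_ne_zero (ne_of_gt ?_) (h i hi)
    exact sum_pos' (fun x' _ => hp _ _)
      ⟨x i, mem_univ _, lt_of_le_of_ne (hp _ _) (h i hi).symm⟩
  simp only [condEnt, h1]
  rw [← sum_pi_pairs (fun (x : Fin n → X) (y : Fin n → Y) => (∏ i, p (x i) (y i)) *
    ∑ i, Real.log ((∑ x', p x' (y i)) / p (x i) (y i)))]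
  rw [sum_pi_sum (f := fun (_ : Fin n) (a : X × Y) => p a.1 a.2)
    (fun _ => by rw [Fintype.sum_prod_type]; exact hp1)
    (fun _ a => Real.log ((∑ x', p x' a.2) / p a.1 a.2))]
  simp [Fintype.sum_prod_type]

/-! ### Single-letterisation through the averaged codeword symbol -/

variable {K : ℕ} {X W B : Type*} {Y U V : Fin K → Type*}
  [Fintype X] [∀ k, Fintype (Y k)]

theorem sum_sourceLaw (P : PMF (X × ∀ k, Y k)) (k : Fin K) (x : X) :
    ∑ y, sourceLaw P k x y = push (wt P) Prod.fst x := sum_push_snd _ _ _ _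

theorem sum_sum_sourceLaw (P : PMF (X × ∀ k, Y k)) (k : Fin K) :
    ∑ x, ∑ y, sourceLaw P k x y = 1 := by
  simp only [sum_sourceLaw, sum_push, sum_wt]

/-- The law of the codeword symbol, averaged over its position. -/
def averageInput (P : PMF (X × ∀ k, Y k)) {ns nc : ℕ} (enc : (Fin ns → X) → (Fin nc → W))
    (w : W) : ℝ :=
  (nc : ℝ)⁻¹ * ∑ j, ∑ x : Fin ns → X, (∏ i, push (wt P) Prod.fst (x i)) * ind (enc x j = w)

theorem averageInput_nonneg (P : PMF (X × ∀ k, Y k)) {ns nc : ℕ}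
    (enc : (Fin ns → X) → (Fin nc → W)) (w : W) : 0 ≤ averageInput P enc w :=
  mul_nonneg (by positivity) (sum_nonneg fun j _ => sum_nonneg fun x _ =>
    mul_nonneg (prod_nonneg fun i _ => push_nonneg (wt_nonneg _) _ _) (ind_nonneg _))

/-- Supplies the absolute continuity in the converse: every output that a codeword of positive
probability can produce has positive weight under the averaged output law. -/
theorem averageInput_pos (P : PMF (X × ∀ k, Y k)) {ns nc : ℕ}
    (enc : (Fin ns → X) → (Fin nc → W)) {x : Fin ns → X}
    (hx : 0 < ∏ i, push (wt P) Prod.fst (x i)) (j : Fin nc) :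
    0 < averageInput P enc (enc x j) := by
  have hnc : 0 < nc := j.pos
  have h0 : ∀ (j' : Fin nc) (x' : Fin ns → X),
      0 ≤ (∏ i, push (wt P) Prod.fst (x' i)) * ind (enc x' j' = enc x j) := fun j' x' =>
    mul_nonneg (prod_nonneg fun i _ => push_nonneg (wt_nonneg _) _ _) (ind_nonneg _)
  refine mul_pos (by positivity) (sum_pos' (fun j' _ => sum_nonneg fun x' _ => h0 j' x')
    ⟨j, mem_univ j, sum_pos' (fun x' _ => h0 j x') ⟨x, mem_univ x, ?_⟩⟩)
  rw [ind_true rfl, mul_one]; exact hx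

theorem sum_averageInput_mul [Fintype W] (P : PMF (X × ∀ k, Y k)) {ns nc : ℕ} (hnc : 0 < nc)
    (enc : (Fin ns → X) → (Fin nc → W)) (D : W → ℝ) :
    nc * ∑ w, averageInput P enc w * D w =
      ∑ x : Fin ns → X, (∏ i, push (wt P) Prod.fst (x i)) * ∑ j, D (enc x j) := by
  have hnc' : (nc : ℝ) ≠ 0 := by positivity
  simp only [averageInput, mul_assoc, ← mul_sum]
  rw [mul_inv_cancel_left₀ hnc']
  simp only [sum_mul, mul_sum]
  rw [sum_comm, sum_comm (s := (univ : Finset (Fin ns → X)))]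
  refine sum_congr rfl fun j _ => ?_
  rw [sum_comm]
  refine sum_congr rfl fun x _ => ?_
  simp only [mul_assoc, ← mul_sum, sum_ind_eq_mul]

theorem sum_averageInput [Fintype W] (P : PMF (X × ∀ k, Y k)) {ns nc : ℕ} (hnc : 0 < nc)
    (enc : (Fin ns → X) → (Fin nc → W)) : ∑ w, averageInput P enc w = 1 := by
  have h := sum_averageInput_mul P hnc enc fun _ => 1
  have h1 : ∑ x : Fin ns → X, ∏ i, push (wt P) Prod.fst (x i) = 1 :=
    sum_pi_prod_eq_one (f := fun _ : Fin ns => push (wt P) Prod.fst)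
      fun _ => (sum_push _ _).trans (sum_wt P)
  have hnc' : (nc : ℝ) ≠ 0 := by positivity
  simp only [mul_one, sum_const, card_univ, Fintype.card_fin, nsmul_eq_mul, ← sum_mul, h1,
    one_mul] at h
  exact mul_left_cancel₀ hnc' (by rw [h, mul_one])

/-- Block converse in single-letter form: the input law is the averaged law of the codeword
symbols. -/
theorem block_condEnt_le [Fintype W] [Fintype B] {C : Type*} [Fintype C]
    (P : PMF (X × ∀ k, Y k)) (k : Fin K) {S : W → B → ℝ} (hS : ∀ w b, 0 ≤ S w b)
    (hS1 : ∀ w, ∑ b, S w b = 1) {ns nc : ℕ} (hnc : 0 < nc) (enc : (Fin ns → X) → (Fin nc → W))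
    (m : (Fin ns → X) → C) (g : (Fin nc → B) → (Fin ns → Y k) → C → (Fin ns → X)) :
    ns * condEnt (sourceLaw P k) ≤ nc * info (averageInput P enc) S +
      Real.log (Fintype.card C) + Real.log 2 +
      (∑ x : Fin ns → X, ∑ y : Fin ns → Y k, ∑ b : Fin nc → B,
        (∏ i, sourceLaw P k (x i) (y i)) * (∏ j, S (enc x j) (b j)) * ind (g b y (m x) ≠ x)) *
        (ns * Real.log (Fintype.card X)) := by
  set Q := averageInput P enc with hQ
  let q : B → ℝ := fun b => ∑ w, Q w * S w b
  have hQ0 : ∀ w, 0 ≤ Q w := averageInput_nonneg P enc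
  have hq : ∀ b, 0 ≤ q b := fun b => sum_nonneg fun w _ => mul_nonneg (hQ0 w) (hS w b)
  have hq1 : ∑ b, q b = 1 := by
    simp only [q]
    rw [sum_comm]
    simp only [← mul_sum, hS1, mul_one]
    exact sum_averageInput P hnc enc
  have hPX : ∀ x : Fin ns → X, ∑ y : Fin ns → Y k, ∏ i, sourceLaw P k (x i) (y i) =
      ∏ i, push (wt P) Prod.fst (x i) := by
    intro x
    rw [sum_pi_prod (fun i y => sourceLaw P k (x i) y)]
    simp only [sum_sourceLaw]
  have hp : ∀ (x : Fin ns → X) (y : Fin ns → Y k), 0 ≤ ∏ i, sourceLaw P k (x i) (y i) :=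
    fun x y => prod_nonneg fun i _ => sourceLaw_nonneg _ _ _ _
  have hp1 : ∑ x : Fin ns → X, ∑ y : Fin ns → Y k, ∏ i, sourceLaw P k (x i) (y i) = 1 := by
    simp only [hPX]
    exact sum_pi_prod_eq_one (f := fun _ : Fin ns => push (wt P) Prod.fst)
      fun _ => (sum_push _ _).trans (sum_wt P)
  have hpos : ∀ (x : Fin ns → X) (b : Fin nc → B), 0 < ∏ i, push (wt P) Prod.fst (x i) →
      0 < ∏ j, S (enc x j) (b j) → ∀ j, 0 < S (enc x j) (b j) ∧ 0 < q (b j) := by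
    intro x b hx hb j
    have h1 : 0 < S (enc x j) (b j) := lt_of_le_of_ne (hS _ _)
      (Finset.prod_ne_zero_iff.1 hb.ne' j (mem_univ j)).symm
    exact ⟨h1, sum_pos' (fun w _ => mul_nonneg (hQ0 w) (hS w _))
      ⟨enc x j, mem_univ _, mul_pos (averageInput_pos P enc hx j) h1⟩⟩
  have hac : ∀ (x : Fin ns → X) (y : Fin ns → Y k) (b : Fin nc → B),
      0 < ∏ i, sourceLaw P k (x i) (y i) → 0 < ∏ j, S (enc x j) (b j) → 0 < ∏ j, q (b j) := by
    intro x y b hx hb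
    have hx' : 0 < ∏ i, push (wt P) Prod.fst (x i) := by
      rw [← hPX]
      exact lt_of_lt_of_le hx (single_le_sum (fun y _ => hp x y) (mem_univ y))
    exact prod_pos fun j _ => (hpos x b hx' hb j).2
  have hmain := condEnt_le_of_decoder hp hp1
    (S := fun (x : Fin ns → X) (b : Fin nc → B) => ∏ j, S (enc x j) (b j))
    (fun x b => prod_nonneg fun j _ => hS _ _)
    (fun x => sum_pi_prod_eq_one (f := fun j => S (enc x j)) fun j => hS1 _)
    (q := fun b : Fin nc → B => ∏ j, q (b j)) (fun b => prod_nonneg fun j _ => hq _)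
    (sum_pi_prod_eq_one (f := fun _ : Fin nc => q) fun _ => hq1) hac m g
  rw [condEnt_block (sourceLaw_nonneg P k) (sum_sum_sourceLaw P k)] at hmain
  have hcard : Real.log (Fintype.card (Fin ns → X)) = ns * Real.log (Fintype.card X) := by
    simp
  rw [hcard] at hmain
  refine hmain.trans (le_of_eq ?_)
  congr 3
  -- Relative to a product law the divergence of the memoryless output is a sum over positions.
  -- Averaging it gives exactly `nc * info Q S`, so neither concavity nor a chain rule is needed.
  rw [info, sum_averageInput_mul P hnc enc]
  refine sum_congr rfl fun x _ => ?_
  rw [← sum_mul, hPX]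
  by_cases hx : ∏ i, push (wt P) Prod.fst (x i) = 0
  · rw [hx, zero_mul, zero_mul]
  have hx' : 0 < ∏ i, push (wt P) Prod.fst (x i) :=
    lt_of_le_of_ne (prod_nonneg fun i _ => push_nonneg (wt_nonneg _) _ _) (Ne.symm hx)
  congr 1
  rw [← sum_pi_sum (f := fun j => S (enc x j)) (fun j => hS1 _)
    (fun j b => Real.log (S (enc x j) b / q b))]
  refine sum_congr rfl fun b _ => ?_
  by_cases hb : ∏ j, S (enc x j) (b j) = 0
  · rw [hb, zero_mul, zero_mul]
  have hb' := hpos x b hx' (lt_of_le_of_ne (prod_nonneg fun j _ => hS _ _) (Ne.symm hb))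
  rw [← prod_div_distrib, Real.log_prod fun j _ => (div_pos (hb' j).1 (hb' j).2).ne']

/-! ### The two cuts for a given code -/

variable [∀ k, Fintype (U k)]

/-- An error event that depends on the channel output only through `h` sees just the channel to `h`,
and only the marginal law of `(X, Y_k)`; both cuts use this form. -/
theorem Code.errorProb_eq_output [Fintype B] {ns nc : ℕ} {R : Fin K → ℝ}
    (c : Code X W Y U V ns nc R) (P : PMF (X × ∀ k, Y k)) (T : W → PMF (∀ k, U k))
    (φ : ∀ k, W → V k) (k : Fin K) (h : W → (∀ k, U k) → B)
    (E : (Fin ns → X) → (Fin ns → Y k) → (Fin nc → B) → Prop)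
    (hE : ∀ x y (t : Fin nc → ∀ k, U k), E x y (fun j => h (c.enc x j) (t j)) ↔
      c.reconstruct φ k x y (fun j => t j k) ≠ x) :
    c.errorProb P T φ k = ∑ x : Fin ns → X, ∑ y : Fin ns → Y k, ∑ b : Fin nc → B,
      (∏ i, sourceLaw P k (x i) (y i)) * (∏ j, outputChannel T h (c.enc x j) (b j)) *
        ind (E x y b) := by
  rw [Code.errorProb_eq]
  have h1 : ∀ (x : Fin ns → X) (y : Fin ns → Y k),
      ∑ b : Fin nc → B, (∏ j, outputChannel T h (c.enc x j) (b j)) * ind (E x y b) =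
      ∑ t : Fin nc → ∀ k, U k, (∏ j, wt (T (c.enc x j)) (t j)) *
        ind (c.reconstruct φ k x y (fun j => t j k) ≠ x) := by
    intro x y
    refine (sum_pi_push (fun j => wt (T (c.enc x j))) (fun j => h (c.enc x j))
      (fun b => ind (E x y b))).trans ?_
    exact sum_congr rfl fun t _ => by rw [ind_congr (hE x y t)]
  simp only [mul_assoc, ← mul_sum, h1]
  rw [← sum_pi_pairs (fun (x : Fin ns → X) (y : Fin ns → Y k) =>
    (∏ i, sourceLaw P k (x i) (y i)) * ∑ t : Fin nc → ∀ k, U k,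
      (∏ j, wt (T (c.enc x j)) (t j)) * ind (c.reconstruct φ k x y (fun j => t j k) ≠ x))]
  exact (sum_pi_push (fun _ : Fin ns => wt P) (fun _ z => (z.1, z.2 k))
    (fun a : Fin ns → X × Y k => ∑ t : Fin nc → ∀ k, U k,
      (∏ j, wt (T (c.enc (fun i => (a i).1) j)) (t j)) *
        ind (c.reconstruct φ k (fun i => (a i).1) (fun i => (a i).2) (fun j => t j k) ≠
          fun i => (a i).1))).symm

theorem Code.condEnt_le_receiver [Fintype W] {ns nc : ℕ} {R : Fin K → ℝ}
    (c : Code X W Y U V ns nc R) (P : PMF (X × ∀ k, Y k)) (T : W → PMF (∀ k, U k))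
    (φ : ∀ k, W → V k) (k : Fin K) (hnc : 0 < nc) :
    ns * condEnt (sourceLaw P k) ≤ nc * info (averageInput P c.enc) (receiverChannel T k) +
      Real.log (numMessages ns (R k)) + Real.log 2 +
      c.errorProb P T φ k * (ns * Real.log (Fintype.card X)) := by
  rw [c.errorProb_eq_output P T φ k (fun _ t => t k)
    (fun x y b => c.dec k b y (c.helper k fun j => φ k (c.enc x j)) ≠ x) fun x y t => Iff.rfl]
  have := block_condEnt_le P k (outputChannel_nonneg T fun _ t => t k)
    (sum_outputChannel T fun _ t => t k) hnc c.enc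
    (fun x => c.helper k fun j => φ k (c.enc x j)) (c.dec k)
  rw [Fintype.card_fin] at this
  exact this

theorem Code.condEnt_le_genie [Fintype W] [∀ k, Fintype (V k)] {ns nc : ℕ} {R : Fin K → ℝ}
    (c : Code X W Y U V ns nc R) (P : PMF (X × ∀ k, Y k)) (T : W → PMF (∀ k, U k))
    (φ : ∀ k, W → V k) (k : Fin K) (hnc : 0 < nc) :
    ns * condEnt (sourceLaw P k) ≤ nc * info (averageInput P c.enc) (genieChannel T φ k) +
      Real.log 2 + c.errorProb P T φ k * (ns * Real.log (Fintype.card X)) := by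
  rw [c.errorProb_eq_output P T φ k (fun w t => (φ k w, t k))
    (fun x y b => c.dec k (fun j => (b j).2) y (c.helper k fun j => (b j).1) ≠ x)
    fun x y t => Iff.rfl]
  -- The message is recomputed from the revealed quantised codeword, so a one-element message set
  -- suffices and its logarithm vanishes.
  have := block_condEnt_le P k (outputChannel_nonneg T fun w t => (φ k w, t k))
    (sum_outputChannel T fun w t => (φ k w, t k)) hnc c.enc (fun _ => ())
    (fun b y _ => c.dec k (fun j => (b j).2) y (c.helper k fun j => (b j).1))
  rw [Fintype.card_unit, Nat.cast_one, Real.log_one, add_zero] at this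
  exact this

/-! ### From codes to a limiting input law -/

theorem log_numMessages_le (n : ℕ) {r : ℝ} (hr : 0 ≤ r) :
    Real.log (numMessages n r) ≤ n * (r * Real.log 2) := by
  have h1 : (0 : ℝ) < numMessages n r := by exact_mod_cast numMessages_pos n hr
  have h2 : (numMessages n r : ℝ) ≤ (2 : ℝ) ^ ((n : ℝ) * r) := Nat.floor_le (by positivity)
  have h3 := Real.log_le_log h1 h2
  rw [Real.log_rpow (by norm_num)] at h3
  linarith

/-- Mutual information as a continuous function of the input law. -/
theorem info_eq [Fintype W] [Fintype B] {Q : W → ℝ} (hQ : ∀ w, 0 ≤ Q w) {S : W → B → ℝ}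
    (hS : ∀ w b, 0 ≤ S w b) :
    info Q S = ∑ w, Q w * ∑ b, S w b * Real.log (S w b) +
      ∑ b, Real.negMulLog (∑ w, Q w * S w b) := by
  simp only [info, Real.negMulLog, neg_mul, sum_mul, mul_sum]
  rw [sum_neg_distrib, sum_comm (s := (univ : Finset B)), ← sub_eq_add_neg, ← sum_sub_distrib]
  refine sum_congr rfl fun w _ => ?_
  rw [← sum_sub_distrib]
  refine sum_congr rfl fun b _ => ?_
  rcases (hQ w).eq_or_lt with h | h
  · simp [← h]
  rcases (hS w b).eq_or_lt with h' | h'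
  · simp [← h']
  have hq : 0 < ∑ w', Q w' * S w' b :=
    sum_pos' (fun w' _ => mul_nonneg (hQ _) (hS _ _)) ⟨w, mem_univ w, mul_pos h h'⟩
  rw [Real.log_div h'.ne' hq.ne']
  ring

theorem tendsto_info [Fintype W] [Fintype B] {S : W → B → ℝ} (hS : ∀ w b, 0 ≤ S w b)
    {Q : ℕ → W → ℝ} (hQ : ∀ n w, 0 ≤ Q n w) {Q' : W → ℝ} (hQ' : ∀ w, 0 ≤ Q' w)
    (h : Filter.Tendsto Q Filter.atTop (nhds Q')) :
    Filter.Tendsto (fun n => info (Q n) S) Filter.atTop (nhds (info Q' S)) := by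
  have hc : Continuous fun Q : W → ℝ => ∑ w, Q w * ∑ b, S w b * Real.log (S w b) +
      ∑ b, Real.negMulLog (∑ w, Q w * S w b) := by
    have := Real.continuous_negMulLog
    fun_prop
  rw [info_eq hQ' hS]
  simp only [info_eq (hQ _) hS]
  exact (hc.tendsto Q').comp h

/-- A point of the standard simplex as a probability mass function. -/
theorem exists_pmf_wt_eq [Fintype W] {Q : W → ℝ} (hQ : ∀ w, 0 ≤ Q w) (hQ1 : ∑ w, Q w = 1) :
    ∃ PW : PMF W, wt PW = Q := by
  refine ⟨PMF.ofFintype (fun w => ENNReal.ofReal (Q w)) ?_, ?_⟩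
  · rw [← ENNReal.ofReal_sum_of_nonneg fun w _ => hQ w, hQ1, ENNReal.ofReal_one]
  · funext w
    simp [wt, hQ w]

theorem exists_input_of_weaklyAchievable [Fintype W] [∀ k, Fintype (V k)]
    {P : PMF (X × ∀ k, Y k)} {T : W → PMF (∀ k, U k)} {κ : ℚ} {R : Fin K → ℝ}
    (hR : ∀ k, 0 ≤ R k) {φ : ∀ k, W → V k} (hach : WeaklyAchievable P T κ R φ)
    {τ : ℝ} (hτ : 0 < τ) :
    ∃ Q ∈ stdSimplex ℝ W, ∀ k,
      condEnt (sourceLaw P k) ≤ κ * info Q (receiverChannel T k) + R k * Real.log 2 + τ ∧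
      condEnt (sourceLaw P k) ≤ κ * info Q (genieChannel T φ k) + τ := by
  have hl : 0 ≤ Real.log (Fintype.card X) := Real.log_natCast_nonneg _
  set l := Real.log (Fintype.card X)
  -- Per source symbol, `log 2` and the error term each cost at most `τ / 2`; `l + 1` guards against
  -- `l = 0`, and `N + 1` makes both blocklengths positive.
  obtain ⟨N, hN⟩ := exists_nat_gt (2 * Real.log 2 / τ)
  obtain ⟨ns, nc, hns, hnc, hratio, c, hc⟩ :=
    hach (τ / (2 * (l + 1))) (by positivity) (N + 1)
  have hns0 : (0 : ℝ) < ns := by exact_mod_cast (by omega : 0 < ns)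
  have hnc0 : 0 < nc := by omega
  have hncκ : (nc : ℝ) = κ * ns := by
    have := (div_eq_iff (by exact_mod_cast hns0.ne' : (ns : ℚ) ≠ 0)).1 hratio
    exact_mod_cast this
  have hslack : ∀ k, Real.log 2 + c.errorProb P T φ k * (ns * l) ≤ ns * τ := by
    intro k
    have h1 : 2 * Real.log 2 < N * τ := by rwa [div_lt_iff₀ hτ] at hN
    have h2 : (N : ℝ) ≤ ns := by exact_mod_cast (by omega : N ≤ ns)
    have h3 := mul_le_mul_of_nonneg_right h2 hτ.le
    have h4 := mul_le_mul_of_nonneg_right (hc k) (mul_nonneg hns0.le hl)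
    have h5 : τ / (2 * (l + 1)) * (ns * l) ≤ ns * τ / 2 := by
      have : τ / (2 * (l + 1)) * (ns * l) = ns * τ / 2 * (l / (l + 1)) := by
        field_simp
      rw [this]
      exact mul_le_of_le_one_right (by positivity) (div_le_one_of_le₀ (by linarith) (by linarith))
    linarith
  refine ⟨averageInput P c.enc,
    ⟨averageInput_nonneg P c.enc, sum_averageInput P hnc0 c.enc⟩, fun k => ⟨?_, ?_⟩⟩
  · refine le_of_mul_le_mul_left ?_ hns0
    have h1 := c.condEnt_le_receiver P T φ k hnc0
    have h2 := log_numMessages_le ns (hR k)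
    have h3 := hslack k
    rw [hncκ] at h1
    linarith
  · refine le_of_mul_le_mul_left ?_ hns0
    have h1 := c.condEnt_le_genie P T φ k hnc0
    have h3 := hslack k
    rw [hncκ] at h1
    linarith

/-- The input laws found for slack `1 / (n + 1)` have a convergent subsequence in the simplex, and
the finitely many informations are continuous along it. -/
theorem exists_pmf_of_weaklyAchievable [Fintype W] [∀ k, Fintype (V k)]
    {P : PMF (X × ∀ k, Y k)} {T : W → PMF (∀ k, U k)} {κ : ℚ} {R : Fin K → ℝ}
    (hR : ∀ k, 0 ≤ R k) {φ : ∀ k, W → V k} (hach : WeaklyAchievable P T κ R φ) :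
    ∃ PW : PMF W, ∀ k,
      condEnt (sourceLaw P k) ≤ κ * info (wt PW) (receiverChannel T k) + R k * Real.log 2 ∧
      condEnt (sourceLaw P k) ≤ κ * info (wt PW) (genieChannel T φ k) := by
  choose Q hQ hb using fun n : ℕ =>
    exists_input_of_weaklyAchievable hR hach (Nat.one_div_pos_of_nat (α := ℝ) (n := n))
  obtain ⟨Q', hQ', ψ, hψ, hlim⟩ := (isCompact_stdSimplex ℝ W).tendsto_subseq hQ
  obtain ⟨PW, hPW⟩ := exists_pmf_wt_eq hQ'.1 hQ'.2
  have hτ : Filter.Tendsto (fun n => 1 / ((ψ n : ℝ) + 1)) Filter.atTop (nhds 0) :=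
    tendsto_one_div_add_atTop_nhds_zero_nat.comp hψ.tendsto_atTop
  refine ⟨PW, fun k => ?_⟩
  rw [hPW]
  constructor
  · have h1 := (((tendsto_info (outputChannel_nonneg T fun _ t => t k)
      (fun n => (hQ (ψ n)).1) hQ'.1 hlim).const_mul (κ : ℝ)).add_const (R k * Real.log 2)).add hτ
    rw [add_zero] at h1
    exact ge_of_tendsto' h1 fun n => (hb (ψ n) k).1
  · have h1 := ((tendsto_info (outputChannel_nonneg T fun w t => (φ k w, t k))
      (fun n => (hQ (ψ n)).1) hQ'.1 hlim).const_mul (κ : ℝ)).add hτ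
    rw [add_zero] at h1
    exact ge_of_tendsto' h1 fun n => (hb (ψ n) k).2

/-- Positivity of `κ` provides arbitrarily large blocklengths of the exact ratio, namely common
multiples of its denominator and numerator; without such blocklengths achievability would be
vacuous. -/
theorem Achievable.weaklyAchievable {P : PMF (X × ∀ k, Y k)} {T : W → PMF (∀ k, U k)} {κ : ℚ}
    (hκ : 0 < κ) {R : Fin K → ℝ} {φ : ∀ k, W → V k} (h : Achievable P T κ R φ) :
    WeaklyAchievable P T κ R φ := by
  intro ε hε N
  obtain ⟨N', hN'⟩ := h ε hε
  have hnum : 0 < κ.num.toNat := by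
    have := Rat.num_pos.2 hκ
    omega
  have hden := κ.den_pos
  set n := N + N' + 1
  have h1 : n ≤ n * κ.den := Nat.le_mul_of_pos_right n hden
  have h2 : n ≤ n * κ.num.toNat := Nat.le_mul_of_pos_right n hnum
  have hratio : ((n * κ.num.toNat : ℕ) : ℚ) / ((n * κ.den : ℕ) : ℚ) = κ := by
    have hn : (n : ℚ) ≠ 0 := by positivity
    have hc : ((κ.num.toNat : ℕ) : ℚ) = (κ.num : ℚ) := by
      have : ((κ.num.toNat : ℕ) : ℤ) = κ.num := Int.toNat_of_nonneg (Rat.num_pos.2 hκ).le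
      exact_mod_cast this
    rw [Nat.cast_mul, Nat.cast_mul, mul_div_mul_left _ _ hn, hc, Rat.num_div_den]
  exact ⟨n * κ.den, n * κ.num.toNat, by omega, by omega, hratio,
    hN' _ _ (by omega) (by omega) hratio⟩

end Converse

end BSCoop

end

theorem theorem1 {K : ℕ} {X W : Type*} {Y U V : Fin K → Type*}
    [Fintype X] [Fintype W] [∀ k, Fintype (Y k)] [∀ k, Fintype (U k)] [∀ k, Fintype (V k)]
    (P : PMF (X × (∀ k, Y k))) (T : W → PMF (∀ k, U k))
    (κ : ℚ) (hκ : 0 < κ) (R : Fin K → ℝ) (hR : ∀ k, 0 ≤ R k) (φ : ∀ k, W → V k) :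
    ((∃ PW : PMF W, ∀ k,
        BSCoop.sourceEquivocation P k < BSCoop.helperBound PW T κ R φ k) →
      BSCoop.Achievable P T κ R φ) ∧
    (BSCoop.Achievable P T κ R φ →
      ∃ PW : PMF W, ∀ k,
        BSCoop.sourceEquivocation P k ≤ BSCoop.helperBound PW T κ R φ k) ∧
    (BSCoop.WeaklyAchievable P T κ R φ →
      ∃ PW : PMF W, ∀ k,
        BSCoop.sourceEquivocation P k ≤ BSCoop.helperBound PW T κ R φ k) := by
  have hconv : BSCoop.WeaklyAchievable P T κ R φ →
      ∃ PW : PMF W, ∀ k,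
        BSCoop.sourceEquivocation P k ≤ BSCoop.helperBound PW T κ R φ k := by
    intro h
    obtain ⟨PW, hPW⟩ := BSCoop.exists_pmf_of_weaklyAchievable hR h
    refine ⟨PW, fun k => le_of_mul_le_mul_right ?_ BSCoop.log_two_pos⟩
    rw [BSCoop.sourceEquivocation_mul_log_two, BSCoop.helperBound_mul_log_two]
    exact le_min (hPW k).1 (hPW k).2
  refine ⟨?_, fun h => hconv (h.weaklyAchievable hκ), hconv⟩
  rintro ⟨PW, hPW⟩
  have hlt : ∀ k, BSCoop.condEnt (BSCoop.sourceLaw P k) < _ ∧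
      BSCoop.condEnt (BSCoop.sourceLaw P k) < _ := fun k => by
    have := mul_lt_mul_of_pos_right (hPW k) BSCoop.log_two_pos
    rw [BSCoop.sourceEquivocation_mul_log_two, BSCoop.helperBound_mul_log_two] at this
    exact lt_min_iff.1 this
  exact BSCoop.achievable_of_lt P T hκ hR φ PW (fun k => (hlt k).1) fun k => (hlt k).2
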